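/- Let $N\ge 2$ be an integer, $\mathbb T=\{z\in\mathbb C: |z|=1\}$ with normalized Haar measure $\mu$; functions on $\mathbb T$ are identified with $2\pi$-periodic functions on $\mathbb R$ by $z=e^{ix}$. For $m_0:\mathbb T\to\mathbb C$ let $(R_{m_0,m_0}f)(z)=\frac1N\sum_{w^N=z}|m_0(w)|^2f(w)$. An $m_0$-cycle is a set $\{z_1,\dots,z_p\}\subset\mathbb T$, $p\ge1$, with $z_i^N=z_{i+1}$ for $i<p$, $z_p^N=z_1$ and $|m_0(z_i)|=\sqrt N$ for all $i$. $L^2(\mathbb R)$ carries the measure $dx/2\pi$, and inner products are linear in the second variable. For $m_0\in L^\infty(\mathbb T)$ and $h\ge0$ in $L^1(\mathbb T)$ with $R_{m_0,m_0}h=h$, a triple $(U,\pi,\varphi)$ consisting of a unitary $U$ on a Hilbert space $\mathcal H$, a unital $*$-representation $\pi$ of $L^\infty(\mathbb T)$ on $\mathcal H$ and $\varphi\in\mathcal H$ is called the cyclic representation associated to $h$ if $U\pi(f)=\pi(f(z^N))U$ and $\langle\varphi\,|\,\pi(f)\varphi\rangle=\int_{\mathbb T}fh\,d\mu$ for all $f\in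 L^\infty(\mathbb T)$, $U\varphi=\pi(m_0)\varphi$, and $\varphi$ is cyclic, i.e. $\mathfrak A\varphi$ is dense in $\mathcal H$, where $\mathfrak A$ is the $C^*$-algebra generated by $U$ and $\pi(z)$. Proposition 11. Let $m_0:\mathbb T\to\mathbb C$ be Lipschitz with $m_0(1)=\sqrt N$ and $R_{m_0,m_0}1=1$. Define $$\varphi_{m_0,1}(x)=\prod_{k=1}^\infty\frac{m_0(x/N^k)}{\sqrt N}\quad(x\in\mathbb R),\qquad h_{m_0,1}(e^{ix})=\sum_{k\in\mathbb Z}|\varphi_{m_0,1}(x+2k\pi)|^2 .$$ (i) The product converges for every $x\in\mathbb R$, and $\varphi_{m_0,1}$ is continuous and belongs to $L^2(\mathbb R)$. (ii) The series defining $h_{m_0,1}$ converges for every $x$; $h_{m_0,1}$ is Lipschitz, and is a trigonometric polynomial if $m_0$ is one; $R_{m_0,m_0}h_{m_0,1}=h_{m_0,1}$; $h_{m_0,1}(1)=1$; and $h_{m_0,1}$ is $0$ on every $m_0$-cycle disjoint from $\{1\}$. (iii) With $(U_1\xi)(x)=\sqrt N\,\xi(Nx)$ and $\pi_1(f)\xi=f\xi$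 on $L^2(\mathbb R)$, for $f\in L^\infty(\mathbb T)$, the triple $(U_1,\pi_1,\varphi_{m_0,1})$ is the cyclic representation associated to $h_{m_0,1}$. (iv) The commutant of this representation (that is, of the $C^*$-algebra generated by $U_1$ and $\pi_1(z)$, and equally of $\{U_1\}\cup\pi_1(L^\infty(\mathbb T))$) is $\{M_f: f\in L^\infty(\mathbb R),\ f(Nx)=f(x)\text{ a.e.}\}$, where $M_f$ is multiplication by $f$. (v) $h_{m_0,1}$ is minimal: if $h'$ is continuous, $R_{m_0,m_0}h'=h'$ and $0\le h'\le c\,h_{m_0,1}$ for some $c>0$, then $h'=\lambda h_{m_0,1}$ for some $\lambda\ge0$. (vi) If $h\ge0$ is continuous, $R_{m_0,m_0}h=h$ and $h(1)=1$, then $h\ge h_{m_0,1}$. -/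

import Mathlib

open MeasureTheory
open scoped ENNReal

namespace WaveletGalerkin

noncomputable section

/-! ### The circle and its normalized Haar measure -/

instance instMeasurableSpaceCircle : MeasurableSpace Circle := borel Circle

instance instBorelSpaceCircle : BorelSpace Circle := ⟨rfl⟩

/-- The normalized Haar measure `μ` on the circle group. -/
def circleHaar : Measure Circle := Measure.haarMeasure ⊤

instance instIsHaarMeasureCircleHaar : circleHaar.IsHaarMeasure := by
  unfold circleHaar; infer_instance

theorem circleHaar_univ : circleHaar Set.univ = 1 :=
  Measure.haarMeasure_self (K₀ := (⊤ : TopologicalSpace.PositiveCompacts Circle))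

instance instIsProbabilityMeasureCircleHaar : IsProbabilityMeasure circleHaar :=
  ⟨circleHaar_univ⟩

/-- Integration against `μ` is integration of `2π`-periodic functions, `z = e^{ix}`, over a
period against `dx / 2π`. -/
theorem measurePreserving_exp :
    MeasurePreserving Circle.exp
      (ENNReal.ofReal (2 * Real.pi)⁻¹ • volume.restrict (Set.Ioc (-Real.pi) Real.pi))
      circleHaar := by
  have : Fact (0 < 2 * Real.pi) := ⟨by positivity⟩
  set η : Measure Circle := Measure.map Circle.exp
      (ENNReal.ofReal (2 * Real.pi)⁻¹ • volume.restrict (Set.Ioc (-Real.pi) Real.pi)) with hη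
  have hpi : -Real.pi + 2 * Real.pi = Real.pi := by ring
  have h1 : η = Measure.map AddCircle.homeomorphCircle'
      (ENNReal.ofReal (2 * Real.pi)⁻¹ • (volume : Measure (AddCircle (2 * Real.pi)))) := by
    have h := (AddCircle.measurePreserving_mk (2 * Real.pi) (-Real.pi)).map_eq
    rw [hpi] at h
    rw [hη, ← h, ← Measure.map_smul,
      Measure.map_map AddCircle.homeomorphCircle'.continuous.measurable
        AddCircle.measurable_mk']
    rfl
  have huniv : η Set.univ = 1 := by
    rw [hη, Measure.map_apply Circle.exp.continuous.measurable MeasurableSet.univ]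
    simp only [Set.preimage_univ, Measure.smul_apply, Measure.restrict_apply, MeasurableSet.univ,
      Set.univ_inter, Real.volume_Ioc, smul_eq_mul]
    rw [← ENNReal.ofReal_mul (by positivity), show Real.pi - -Real.pi = 2 * Real.pi by ring,
      inv_mul_cancel₀ (by positivity), ENNReal.ofReal_one]
  have : IsProbabilityMeasure η := ⟨huniv⟩
  have : η.IsMulLeftInvariant := by
    refine ⟨fun g => ?_⟩
    obtain ⟨t, rfl⟩ := AddCircle.homeomorphCircle'.surjective g
    rw [h1, Measure.map_map (measurable_const_mul _)
      AddCircle.homeomorphCircle'.continuous.measurable]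
    have h2 : (fun w => AddCircle.homeomorphCircle' t * w) ∘ AddCircle.homeomorphCircle' =
        AddCircle.homeomorphCircle' ∘ (fun s => t + s) := by
      funext s
      induction t using QuotientAddGroup.induction_on
      induction s using QuotientAddGroup.induction_on
      exact (Circle.exp_add _ _).symm
    rw [h2, ← Measure.map_map AddCircle.homeomorphCircle'.continuous.measurable
      (measurable_const_add t), Measure.map_smul, map_add_left_eq_self]
  refine ⟨Circle.exp.continuous.measurable, ?_⟩
  have := Measure.haarMeasure_unique η (⊤ : TopologicalSpace.PositiveCompacts Circle)
  rw [← hη, this]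
  simp [circleHaar, huniv]

/-- `L^∞(𝕋)`. -/
abbrev LInftyCircle : Type := Lp ℂ ∞ circleHaar

/-- The class of a continuous function in `L^∞(𝕋)`. -/
def ofContinuous (f : Circle → ℂ) (hf : Continuous f) : LInftyCircle :=
  ContinuousMap.toLp ∞ circleHaar ℂ ⟨f, hf⟩

/-- The function `z ↦ z` in `L^∞(𝕋)`. -/
def coordinate : LInftyCircle := ofContinuous (fun z => (z : ℂ)) continuous_subtype_val

theorem measurePreserving_pow {N : ℕ} (hN : 2 ≤ N) :
    MeasurePreserving (fun z : Circle => z ^ N) circleHaar circleHaar := by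
  have h := MonoidHom.measurePreserving (μ := circleHaar) (ν := circleHaar)
    (f := powMonoidHom (α := Circle) N) (continuous_pow N) (fun z => ?_) rfl
  · exact h
  · refine ⟨Circle.exp (Complex.arg z / N), ?_⟩
    have h0 : (N : ℝ) ≠ 0 := by positivity
    change Circle.exp (Complex.arg z / N) ^ N = z
    rw [← Circle.exp_natCast_mul, mul_div_cancel₀ _ h0, Circle.exp_arg]

/-- `f(z) ↦ f(z^N)` on `L^∞(𝕋)`. -/
def powComp {N : ℕ} (hN : 2 ≤ N) (f : LInftyCircle) : LInftyCircle :=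
  Lp.compMeasurePreserving (fun z : Circle => z ^ N) (measurePreserving_pow hN) f

theorem coeFn_powComp {N : ℕ} (hN : 2 ≤ N) (f : LInftyCircle) :
    powComp hN f =ᵐ[circleHaar] fun z => f (z ^ N) :=
  Lp.coeFn_compMeasurePreserving f (measurePreserving_pow hN)

/-! ### The Ruelle operator, cycles, the infinite product -/

/-- The Ruelle (wavelet Galerkin) operator
`(R_{m,m'} f)(z) = (1/N) ∑_{w^N = z} conj (m w) * m' w * f w`. -/
def ruelle (N : ℕ) (m m' : Circle → ℂ) (f : Circle → ℂ) (z : Circle) : ℂ :=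
  (1 / (N : ℂ)) * ∑ᶠ w ∈ {w : Circle | w ^ N = z}, (starRingEnd ℂ) (m w) * m' w * f w

/-- The sum in `ruelle` is a genuine finite sum. -/
theorem finite_roots {N : ℕ} (hN : 2 ≤ N) (z : Circle) : {w : Circle | w ^ N = z}.Finite := by
  have h : ((Polynomial.nthRoots N (z : ℂ)).toFinset : Set ℂ).Finite := Finset.finite_toSet _
  refine (h.preimage (f := fun w : Circle => (w : ℂ)) Subtype.val_injective.injOn).subset ?_
  intro w hw
  simp only [Set.mem_preimage, Finset.mem_coe, Multiset.mem_toFinset]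
  rw [Polynomial.mem_nthRoots (by omega), ← Circle.coe_pow, hw]

/-- `h : 𝕋 → ℝ` is a fixed point of `R_{m₀,m₀}`. -/
def IsRuelleFixed (N : ℕ) (m₀ : Circle → ℂ) (h : Circle → ℝ) : Prop :=
  ∀ z, ruelle N m₀ m₀ (fun w => (h w : ℂ)) z = (h z : ℂ)

/-- `C = {z_1, …, z_p}` (with `p ≥ 1`) is an `m₀`-cycle; the index `i + 1` is cyclic. -/
def IsCycle (N : ℕ) (m₀ : Circle → ℂ) (C : Set Circle) : Prop :=
  ∃ (p : ℕ) (z : Fin (p + 1) → Circle), C = Set.range z ∧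
    (∀ i, z i ^ N = z (i + 1)) ∧ ∀ i, ‖m₀ (z i)‖ = √(N : ℝ)

/-- A trigonometric polynomial on the circle. -/
def IsTrigPolynomial (f : Circle → ℂ) : Prop :=
  ∃ a : ℤ →₀ ℂ, ∀ z : Circle, f z = a.sum fun n c => c * (z : ℂ) ^ n

/-- The factor `m₀(x / N^(k+1)) / √N`, functions on `𝕋` being viewed as `2π`-periodic. -/
def factor (N : ℕ) (m₀ : Circle → ℂ) (x : ℝ) (k : ℕ) : ℂ :=
  m₀ (Circle.exp (x / (N : ℝ) ^ (k + 1))) / ((√(N : ℝ) : ℝ) : ℂ)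

/-- `φ_{m₀,1}(x) = ∏_{k ≥ 1} m₀(x / N^k) / √N`. -/
def scalingFunction (N : ℕ) (m₀ : Circle → ℂ) (x : ℝ) : ℂ :=
  ∏' k : ℕ, factor N m₀ x k

/-- `Per(f)(x) = ∑_{k ∈ ℤ} f(x + 2kπ)`. -/
def periodization (f : ℝ → ℝ) (x : ℝ) : ℝ := ∑' k : ℤ, f (x + 2 * k * Real.pi)

/-- `h_{m₀,1} = Per |φ_{m₀,1}|²` as a function on the circle. -/
def hFunction (N : ℕ) (m₀ : Circle → ℂ) (z : Circle) : ℝ :=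
  periodization (fun x => ‖scalingFunction N m₀ x‖ ^ 2) (Complex.arg z)

/-! ### Cyclic representations -/

section Representation

variable {H : Type*} [NormedAddCommGroup H] [InnerProductSpace ℂ H] [CompleteSpace H]

/-- The C*-algebra generated by the operators `U` and `V = π(z)`, that is the image of the
algebra `𝔄_N` under the representation given by `U` and `π`. -/
def generatedAlgebra (U : H →L[ℂ] H) (π : LInftyCircle → H →L[ℂ] H) :
    StarSubalgebra ℂ (H →L[ℂ] H) :=
  (StarAlgebra.adjoin ℂ {U, π coordinate}).topologicalClosure

/-- `(U, π, φ)` is the cyclic representation associated to `h` (and `m₀`): `U` is unitary, `π` is a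
unital `*`-representation of `L^∞(𝕋)`, `U π(f) = π(f(z^N)) U`, `U φ = π(m₀) φ`,
`⟪φ, π(f) φ⟫ = ∫ f h dμ`, and `φ` is a cyclic vector. -/
structure IsCyclicRepresentation {N : ℕ} (hN : 2 ≤ N) (m₀ : LInftyCircle) (h : Circle → ℝ)
    (U : H →L[ℂ] H) (π : LInftyCircle → H →L[ℂ] H) (φ : H) : Prop where
  unitary : U ∈ unitary (H →L[ℂ] H)
  map_one : π (Lp.const ∞ circleHaar (1 : ℂ)) = 1
  map_add : ∀ f g, π (f + g) = π f + π g
  map_smul : ∀ (c : ℂ) (f), π (c • f) = c • π f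
  map_mul : ∀ f g : LInftyCircle, π (f • g : LInftyCircle) = π f * π g
  map_star : ∀ f, π (star f) = star (π f)
  covariance : ∀ f, U * π f = π (powComp hN f) * U
  scaling : U φ = π m₀ φ
  inner_eq : ∀ f : LInftyCircle, inner ℂ φ (π f φ) = ∫ z, f z * (h z : ℂ) ∂circleHaar
  cyclic : Dense {ξ : H | ∃ A ∈ generatedAlgebra U π, ξ = A φ}

end Representation

/-! ### The representation on `L²(ℝ)` -/

/-- The measure `dx / 2π` on `ℝ`. -/
def lineMeasure : Measure ℝ := ENNReal.ofReal (2 * Real.pi)⁻¹ • volume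

theorem ofReal_two_pi_inv_ne_zero : ENNReal.ofReal (2 * Real.pi)⁻¹ ≠ 0 := by
  have : 0 < (2 * Real.pi)⁻¹ := by positivity
  simpa using this

/-- `L²(ℝ, dx / 2π)`. -/
abbrev L2Line : Type := Lp ℂ 2 lineMeasure

/-- `L^∞(ℝ)` (`dx / 2π` and Lebesgue measure have the same null sets). -/
abbrev LInftyLine : Type := Lp ℂ ∞ lineMeasure

/-- The operator `M_g` of multiplication by `g ∈ L^∞(ℝ)` on `L²(ℝ)`. -/
def mulOp (g : LInftyLine) : L2Line →L[ℂ] L2Line :=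
  (ContinuousLinearMap.mul ℂ ℂ).holderL lineMeasure ∞ 2 2 g

theorem coeFn_mulOp (g : LInftyLine) (ξ : L2Line) :
    mulOp g ξ =ᵐ[lineMeasure] fun x => g x * ξ x :=
  (ContinuousLinearMap.mul ℂ ℂ).coeFn_holder g ξ

theorem quasiMeasurePreserving_exp :
    Measure.QuasiMeasurePreserving Circle.exp lineMeasure circleHaar := by
  refine ⟨Circle.exp.continuous.measurable, ?_⟩
  refine Measure.AbsolutelyContinuous.mk fun s hs h0 => ?_
  rw [Measure.map_apply Circle.exp.continuous.measurable hs, lineMeasure, Measure.smul_apply,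
    smul_eq_mul]
  have h1 := measurePreserving_exp.measure_preimage hs.nullMeasurableSet
  rw [h0, Measure.smul_apply, smul_eq_mul, mul_eq_zero,
    or_iff_right ofReal_two_pi_inv_ne_zero,
    Measure.restrict_apply (Circle.exp.continuous.measurable hs)] at h1
  have h2 := (isAddFundamentalDomain_Ioc (show 0 < 2 * Real.pi by positivity)
    (-Real.pi) volume).measure_zero_of_invariant (Circle.exp ⁻¹' s) (fun g => ?_) ?_
  · rw [h2, mul_zero]
  · obtain ⟨_, n, rfl⟩ := g
    ext x
    rw [Set.mem_vadd_set_iff_neg_vadd_mem]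
    simp only [Set.mem_preimage]
    have : Circle.exp (-(n • (2 * Real.pi)) + x) = Circle.exp x := by
      have h := (Circle.periodic_exp.zsmul (-n)) x
      rw [neg_smul, add_comm] at h
      exact h
    change Circle.exp (-(n • (2 * Real.pi)) + x) ∈ s ↔ _
    rw [this]
  · rwa [show -Real.pi + 2 * Real.pi = Real.pi by ring]

/-- `f ∈ L^∞(𝕋)` as the `2π`-periodic function `x ↦ f(e^{ix})` in `L^∞(ℝ)`. -/
def periodicExtension (f : LInftyCircle) : LInftyLine :=
  ⟨f.1.compQuasiMeasurePreserving Circle.exp quasiMeasurePreserving_exp, by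
    rw [Lp.mem_Lp_iff_eLpNorm_lt_top,
      eLpNorm_congr_ae (AEEqFun.coeFn_compQuasiMeasurePreserving f.1 quasiMeasurePreserving_exp),
      eLpNorm_exponent_top]
    refine lt_of_le_of_lt ?_ (Lp.eLpNorm_lt_top f)
    rw [eLpNorm_exponent_top]
    exact (essSup_comp_le_essSup_map_measure (f := Circle.exp) (g := fun z => ‖f z‖ₑ)
      Circle.exp.continuous.aemeasurable).trans
      (essSup_mono_measure quasiMeasurePreserving_exp.absolutelyContinuous)⟩

theorem coeFn_periodicExtension (f : LInftyCircle) :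
    periodicExtension f =ᵐ[lineMeasure] fun x => f (Circle.exp x) :=
  AEEqFun.coeFn_compQuasiMeasurePreserving f.1 quasiMeasurePreserving_exp

/-- `π₁(f) ξ = f ξ`. -/
def piOne (f : LInftyCircle) : L2Line →L[ℂ] L2Line := mulOp (periodicExtension f)

theorem map_lineMeasure {N : ℕ} (hN : 2 ≤ N) :
    Measure.map (fun x : ℝ => (N : ℝ) * x) lineMeasure =
      ENNReal.ofReal (N : ℝ)⁻¹ • lineMeasure := by
  have h0 : (N : ℝ) ≠ 0 := by positivity
  have h1 : |(N : ℝ)⁻¹| = (N : ℝ)⁻¹ := abs_of_nonneg (by positivity)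
  rw [lineMeasure, Measure.map_smul, Real.map_volume_mul_left h0, h1, smul_comm]

theorem quasiMeasurePreserving_mul {N : ℕ} (hN : 2 ≤ N) :
    Measure.QuasiMeasurePreserving (fun x : ℝ => (N : ℝ) * x) lineMeasure lineMeasure := by
  refine ⟨measurable_const_mul _, ?_⟩
  rw [map_lineMeasure hN]
  exact Measure.smul_absolutelyContinuous

theorem eLpNorm_comp_mul_le {N : ℕ} (hN : 2 ≤ N) (ξ : L2Line) :
    eLpNorm (ξ.1.compQuasiMeasurePreserving (fun x : ℝ => (N : ℝ) * x)
      (quasiMeasurePreserving_mul hN)) 2 lineMeasure ≤ eLpNorm ξ 2 lineMeasure := by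
  rw [eLpNorm_congr_ae (AEEqFun.coeFn_compQuasiMeasurePreserving ξ.1 _),
    ← eLpNorm_map_measure _ (measurable_const_mul _).aemeasurable, map_lineMeasure hN]
  · refine eLpNorm_mono_measure _ (Measure.le_iff.2 fun s _ => ?_)
    rw [Measure.smul_apply, smul_eq_mul]
    refine mul_le_of_le_one_left' ?_
    rw [ENNReal.ofReal_le_one]
    exact inv_le_one_of_one_le₀ (by exact_mod_cast (by omega : 1 ≤ N))
  · rw [map_lineMeasure hN]
    exact ξ.1.aestronglyMeasurable.mono_ac Measure.smul_absolutelyContinuous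

/-- `ξ ↦ ξ(N ·)` on `L²(ℝ)`. -/
def dilate {N : ℕ} (hN : 2 ≤ N) : L2Line →L[ℂ] L2Line :=
  LinearMap.mkContinuous
    { toFun := fun ξ => ⟨ξ.1.compQuasiMeasurePreserving (fun x : ℝ => (N : ℝ) * x)
        (quasiMeasurePreserving_mul hN), (eLpNorm_comp_mul_le hN ξ).trans_lt (Lp.eLpNorm_lt_top ξ)⟩
      map_add' := by rintro ⟨⟨_⟩, _⟩ ⟨⟨_⟩, _⟩; rfl
      map_smul' := by rintro c ⟨⟨_⟩, _⟩; rfl } 1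
    (fun ξ => by
      rw [one_mul, Lp.norm_def, Lp.norm_def]
      exact ENNReal.toReal_mono (Lp.eLpNorm_ne_top ξ) (eLpNorm_comp_mul_le hN ξ))

theorem coeFn_dilate {N : ℕ} (hN : 2 ≤ N) (ξ : L2Line) :
    dilate hN ξ =ᵐ[lineMeasure] fun x => ξ (N * x) :=
  AEEqFun.coeFn_compQuasiMeasurePreserving ξ.1 (quasiMeasurePreserving_mul hN)

/-- `(U₁ ξ)(x) = √N ξ(N x)`. -/
def uOne {N : ℕ} (hN : 2 ≤ N) : L2Line →L[ℂ] L2Line := ((√(N : ℝ) : ℝ) : ℂ) • dilate hN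

/-- `{M_f | f ∈ L^∞(ℝ), f(N x) = f(x) a.e.}`. -/
def dilationInvariantMultipliers (N : ℕ) : Set (L2Line →L[ℂ] L2Line) :=
  {S | ∃ f : LInftyLine, (∀ᵐ x ∂(volume : Measure ℝ), f (N * x) = f x) ∧ S = mulOp f}

end

end WaveletGalerkin

open WaveletGalerkin

namespace WaveletGalerkin

/-! ### The infinite product and its partial products. -/

section Product

open Filter Topology

variable {N : ℕ} {m₀ : Circle → ℂ} {K : NNReal}

/-! Write φ for the infinite product, h for the periodization of |φ|², and W_n for the product of
the first n factors |m₀(x/N^k)|²/N. Iterating the Ruelle operator R gives R^n f(e^{ix}) = Σ_j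
W_n(x+2jπ) f(e^{i(x+2jπ)/N^n}), with j running over any N^n consecutive integers. Since R1 = 1,
these weights form a probability distribution. They converge pointwise to |φ|², so a Fatou argument
gives Σ_j |φ(x+2jπ)|² ≤ 1.

The main tool is `tendsto_iterate_ruelle`: if f is continuous and supported near 1, then R^n f →
f(1) h pointwise. The reason is the identity |φ(y)|² = W_n(y)|φ(y/N^n)|²: near 0 one has |φ|² ≥ 1/2,
so W_n(y) ≤ 2|φ(y)|² whenever y/N^n is small, and dominated convergence applies.

Let χ be a bump at 1. Then R^n χ → h shows that h is fixed, and that h is Lipschitz because R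
preserves a suitable Lipschitz bound. A nonnegative fixed point g satisfies g = R^n g ≥ R^n(χg) →
g(1) h, which is the comparison statement. If 0 ≤ h' ≤ c h, the remainder R^n((1-χ)h') is at most c
R^n((1-χ)h) → 0, so h' = h'(1) h. If m₀ is a trigonometric polynomial, R lowers degrees to a fixed
bound, and h is a limit inside a finite-dimensional space. On a cycle avoiding 1, the backward orbit
y/N^k of any lift y must leave the cycle, and it can do so only through a zero of m₀.

On L²(ℝ), conjugating multiplication by e^{ix} with powers of U₁ produces the characters e^{itx} for
a dense set of t. Fourier uniqueness (`ae_eq_zero_of_integral_exp_mul_eq_zero`) then makes every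
operator commuting with them a multiplication operator. It also gives cyclicity: φ does not vanish
near 0, and dilations carry this neighbourhood over the whole line. -/

theorem norm_exp_sub_exp_le (x y : ℝ) : ‖(Circle.exp x : ℂ) - Circle.exp y‖ ≤ |x - y| := by
  have h : (Circle.exp x : ℂ) - Circle.exp y
      = Circle.exp y * (Complex.exp (Complex.I * ((x - y : ℝ) : ℂ)) - 1) := by
    rw [mul_sub, mul_one, Circle.coe_exp, Circle.coe_exp, ← Complex.exp_add]
    congr 2
    push_cast; ring
  rw [h, norm_mul, Circle.norm_coe, one_mul]
  exact Real.norm_exp_I_mul_ofReal_sub_one_le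

theorem dist_exp_le (x y : ℝ) : dist (Circle.exp x) (Circle.exp y) ≤ |x - y| := by
  change dist (Circle.exp x : ℂ) (Circle.exp y) ≤ _
  rw [dist_eq_norm]
  exact norm_exp_sub_exp_le x y

theorem exp_add_two_mul_int_mul_pi (x : ℝ) (k : ℤ) :
    Circle.exp (x + 2 * k * Real.pi) = Circle.exp x :=
  Circle.exp_eq_exp.2 ⟨k, by ring⟩

theorem continuous_factor (hm : Continuous m₀) (k : ℕ) : Continuous fun x => factor N m₀ x k := by
  unfold factor
  have := Circle.exp.continuous
  fun_prop

/-- The k-th argument lies within |x|/N^(k+1) of 1, and there the Lipschitz condition applies. The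
geometric bound, locally uniform in x, yields both convergence and continuity of the product; the
ratio 1/2 is a crude replacement for 1/N. -/
theorem norm_factor_sub_one_le (hN : 2 ≤ N) (hLip : LipschitzWith K m₀)
    (hone : m₀ 1 = ((√(N : ℝ) : ℝ) : ℂ)) (x : ℝ) (k : ℕ) :
    ‖factor N m₀ x k - 1‖ ≤ K * |x| * (1 / 2) ^ k := by
  have hs : (1 : ℝ) ≤ √(N : ℝ) := by
    rw [Real.one_le_sqrt]; exact_mod_cast (by omega : 1 ≤ N)
  have hs0 : ((√(N : ℝ) : ℝ) : ℂ) ≠ 0 := by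
    rw [Complex.ofReal_ne_zero]; positivity
  have h1 : factor N m₀ x k - 1 =
      (m₀ (Circle.exp (x / (N : ℝ) ^ (k + 1))) - m₀ 1) / ((√(N : ℝ) : ℝ) : ℂ) := by
    rw [factor, hone, sub_div, div_self hs0]
  have h2 : ‖m₀ (Circle.exp (x / (N : ℝ) ^ (k + 1))) - m₀ 1‖ ≤ K * |x / (N : ℝ) ^ (k + 1)| := by
    rw [← dist_eq_norm]
    refine (hLip.dist_le_mul _ _).trans ?_
    gcongr
    simpa using dist_exp_le (x / (N : ℝ) ^ (k + 1)) 0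
  have h3 : |x / (N : ℝ) ^ (k + 1)| ≤ |x| * (1 / 2) ^ k := by
    have hp : (2 : ℝ) ^ k ≤ (N : ℝ) ^ (k + 1) := by
      have h2N : (2 : ℝ) ≤ N := by exact_mod_cast hN
      calc (2 : ℝ) ^ k ≤ (N : ℝ) ^ k := by gcongr
        _ ≤ (N : ℝ) ^ (k + 1) := pow_le_pow_right₀ (by linarith) (by omega)
    rw [abs_div, abs_of_pos (show (0 : ℝ) < (N : ℝ) ^ (k + 1) by positivity), div_eq_mul_inv,
      one_div, inv_pow]
    gcongr
  rw [h1, norm_div, Complex.norm_real, Real.norm_of_nonneg (by positivity)]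
  calc _ ≤ ‖m₀ (Circle.exp (x / (N : ℝ) ^ (k + 1))) - m₀ 1‖ := div_le_self (norm_nonneg _) hs
    _ ≤ K * (|x| * (1 / 2) ^ k) := h2.trans (by gcongr)
    _ = _ := by ring

theorem multipliable_factor (hN : 2 ≤ N) (hLip : LipschitzWith K m₀)
    (hone : m₀ 1 = ((√(N : ℝ) : ℝ) : ℂ)) (x : ℝ) : Multipliable (factor N m₀ x) := by
  have h : Summable fun k => ‖factor N m₀ x k - 1‖ :=
    Summable.of_nonneg_of_le (fun _ => norm_nonneg _) (norm_factor_sub_one_le hN hLip hone x)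
      ((summable_geometric_of_lt_one (by norm_num) (by norm_num)).mul_left _)
  simpa using multipliable_one_add_of_summable h

theorem continuous_scalingFunction (hN : 2 ≤ N) (hLip : LipschitzWith K m₀)
    (hone : m₀ 1 = ((√(N : ℝ) : ℝ) : ℂ)) : Continuous (scalingFunction N m₀) := by
  rw [continuous_iff_continuousAt]
  intro x
  have h := Summable.hasProdLocallyUniformlyOn_nat_one_add (f := fun k x => factor N m₀ x k - 1)
    (K := Metric.ball (0 : ℝ) (|x| + 1)) (u := fun k => K * (|x| + 1) * (1 / 2) ^ k)
    Metric.isOpen_ball ((summable_geometric_of_lt_one (by norm_num) (by norm_num)).mul_left _)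
    (Eventually.of_forall fun k y hy => (norm_factor_sub_one_le hN hLip hone y k).trans (by
      rw [mem_ball_zero_iff, Real.norm_eq_abs] at hy
      gcongr))
    (fun k => ((continuous_factor hLip.continuous k).sub continuous_const).continuousOn)
  have h2 := h.tendstoLocallyUniformlyOn_finsetRange.continuousOn
    (Eventually.of_forall fun n => (continuous_finsetProd _ fun k _ =>
      continuous_const.add ((continuous_factor hLip.continuous k).sub continuous_const)).continuousOn).frequently
  have h3 : scalingFunction N m₀ = fun x => ∏' i, (1 + (factor N m₀ x i - 1)) := by
    funext y; simp [scalingFunction]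
  rw [h3]
  exact h2.continuousAt (Metric.isOpen_ball.mem_nhds (by simp))

theorem scalingFunction_zero (hN : 2 ≤ N) (hone : m₀ 1 = ((√(N : ℝ) : ℝ) : ℂ)) :
    scalingFunction N m₀ 0 = 1 := by
  have hs0 : ((√(N : ℝ) : ℝ) : ℂ) ≠ 0 := by
    rw [Complex.ofReal_ne_zero]; positivity
  simp [scalingFunction, factor, hone, hs0]

theorem scalingFunction_eq_prod_mul (hN : 2 ≤ N) (hLip : LipschitzWith K m₀)
    (hone : m₀ 1 = ((√(N : ℝ) : ℝ) : ℂ)) (x : ℝ) (n : ℕ) :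
    scalingFunction N m₀ x =
      (∏ k ∈ Finset.range n, factor N m₀ x k) * scalingFunction N m₀ (x / (N : ℝ) ^ n) := by
  have hx : ∀ k, factor N m₀ (x / (N : ℝ) ^ n) k = factor N m₀ x (k + n) := by
    intro k
    rw [factor, factor, div_div, ← pow_add]
    congr 5; ring
  rw [scalingFunction, scalingFunction]
  simp_rw [hx]
  refine (Multipliable.prod_mul_tprod_nat_mul' ?_).symm
  exact (multipliable_factor hN hLip hone (x / (N : ℝ) ^ n)).congr hx

/-- The refinement equation: it is the relation U₁φ = π₁(m₀)φ, read pointwise. -/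
theorem sqrt_mul_scalingFunction_mul (hN : 2 ≤ N) (hLip : LipschitzWith K m₀)
    (hone : m₀ 1 = ((√(N : ℝ) : ℝ) : ℂ)) (x : ℝ) :
    ((√(N : ℝ) : ℝ) : ℂ) * scalingFunction N m₀ (N * x) =
      m₀ (Circle.exp x) * scalingFunction N m₀ x := by
  have hN0 : (N : ℝ) ≠ 0 := by positivity
  have hs0 : ((√(N : ℝ) : ℝ) : ℂ) ≠ 0 := by
    rw [Complex.ofReal_ne_zero]; positivity
  rw [scalingFunction_eq_prod_mul hN hLip hone (N * x) 1, Finset.prod_range_one, factor, zero_add,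
    pow_one, mul_div_cancel_left₀ _ hN0]
  field_simp

/-- The partial products of `|φ_{m₀,1}|²`. -/
noncomputable def partialWeight (N : ℕ) (m₀ : Circle → ℂ) (n : ℕ) (x : ℝ) : ℝ :=
  ∏ k ∈ Finset.range n, ‖factor N m₀ x k‖ ^ 2

theorem partialWeight_nonneg (n : ℕ) (x : ℝ) : 0 ≤ partialWeight N m₀ n x :=
  Finset.prod_nonneg fun _ _ => by positivity

theorem tendsto_partialWeight (hN : 2 ≤ N) (hLip : LipschitzWith K m₀)
    (hone : m₀ 1 = ((√(N : ℝ) : ℝ) : ℂ)) (x : ℝ) :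
    Tendsto (fun n => partialWeight N m₀ n x) atTop (𝓝 (‖scalingFunction N m₀ x‖ ^ 2)) := by
  have h := ((multipliable_factor hN hLip hone x).hasProd.tendsto_prod_nat).norm.pow 2
  simpa only [partialWeight, scalingFunction, Finset.prod_pow, norm_prod] using h

/-- Compares a partial product with its own limit. Where the last factor is bounded below, the
partial weight is dominated by a multiple of |φ|². -/
theorem norm_scalingFunction_sq_eq (hN : 2 ≤ N) (hLip : LipschitzWith K m₀)
    (hone : m₀ 1 = ((√(N : ℝ) : ℝ) : ℂ)) (x : ℝ) (n : ℕ) :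
    ‖scalingFunction N m₀ x‖ ^ 2 =
      partialWeight N m₀ n x * ‖scalingFunction N m₀ (x / (N : ℝ) ^ n)‖ ^ 2 := by
  rw [scalingFunction_eq_prod_mul hN hLip hone x n, norm_mul, mul_pow, partialWeight,
    Finset.prod_pow, norm_prod]

theorem exists_half_le_norm_scalingFunction_sq (hN : 2 ≤ N) (hLip : LipschitzWith K m₀)
    (hone : m₀ 1 = ((√(N : ℝ) : ℝ) : ℂ)) :
    ∃ ε > 0, ∀ x : ℝ, |x| < ε → 1 / 2 ≤ ‖scalingFunction N m₀ x‖ ^ 2 := by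
  have hc : Continuous fun x => ‖scalingFunction N m₀ x‖ ^ 2 :=
    (continuous_scalingFunction hN hLip hone).norm.pow 2
  have h : ∀ᶠ x in 𝓝 (0 : ℝ), 1 / 2 < ‖scalingFunction N m₀ x‖ ^ 2 :=
    hc.continuousAt.eventually_const_lt (by
      simp only [scalingFunction_zero hN hone]; norm_num)
  obtain ⟨ε, hε, hb⟩ := Metric.eventually_nhds_iff.1 h
  exact ⟨ε, hε, fun x hx => (hb (by simpa using hx)).le⟩

end Product

/-! ### Iterates of the Ruelle operator as weighted sums over translates. -/

section Iterates

open Filter Topology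

variable {N : ℕ} {m₀ : Circle → ℂ} {K : NNReal}

/-- Any M consecutive integers represent each residue class modulo M exactly once. -/
theorem sum_range_eq_sum_Ico_of_periodic {E : Type*} [AddCommMonoid E] {M : ℕ} (hM : 0 < M)
    {F : ℤ → E} (hF : ∀ j, F (j + M) = F j) (a : ℤ) :
    ∑ j ∈ Finset.range M, F j = ∑ j ∈ Finset.Ico a (a + M), F j := by
  have hper : Function.Periodic F M := hF
  have hmod : ∀ j, F (j % M) = F j := fun j => by
    have := hper.sub_zsmul_eq (x := j) (j / M)
    rw [← this]
    congr 1
    have := Int.emod_add_mul_ediv j M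
    simp only [smul_eq_mul]
    lia
  have h0 : (0 : ℤ) ≤ M := by positivity
  have hinj : Set.InjOn (· % (M : ℤ)) (Finset.Ico a (a + M) : Set ℤ) := by
    intro i hi j hj hij
    simp only [Finset.coe_Ico, Set.mem_Ico] at hi hj
    have h1 : (M : ℤ) ∣ i - j := Int.ModEq.dvd (Int.ModEq.symm hij)
    have h2 := Int.eq_zero_of_abs_lt_dvd h1 (by rw [abs_lt]; constructor <;> linarith)
    linarith
  calc ∑ j ∈ Finset.range M, F j = ∑ j ∈ Finset.Ico (0 : ℤ) M, F j := by
        rw [Finset.range_eq_Ico]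
        refine Finset.sum_nbij (fun n => (n : ℤ)) ?_ ?_ ?_ ?_
        · intro n hn; simp at hn ⊢; exact hn
        · intro i _ j _ h; simpa using h
        · intro n hn
          simp only [Finset.coe_Ico, Set.mem_Ico] at hn
          exact ⟨n.toNat, by simp; lia, by simp; lia⟩
        · intros; rfl
    _ = ∑ j ∈ (Finset.Ico a (a + M)).image (· % (M : ℤ)), F j := by rw [Int.image_Ico_emod a M h0]
    _ = ∑ j ∈ Finset.Ico a (a + M), F (j % M) := Finset.sum_image hinj
    _ = _ := Finset.sum_congr rfl fun j _ => hmod j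

/-- The `N`-th roots of `e^{ix}` are the points `e^{i(x + 2jπ)/N}`. -/
theorem finsum_roots_eq {E : Type*} [AddCommMonoid E] (hN : 2 ≤ N) (F : Circle → E) (x : ℝ) :
    ∑ᶠ w ∈ {w : Circle | w ^ N = Circle.exp x}, F w =
      ∑ j ∈ Finset.range N, F (Circle.exp ((x + 2 * j * Real.pi) / N)) := by
  have hN0 : (N : ℝ) ≠ 0 := by positivity
  have hset : {w : Circle | w ^ N = Circle.exp x} =
      (fun j : ℕ => Circle.exp ((x + 2 * j * Real.pi) / N)) '' (Finset.range N : Set ℕ) := by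
    ext w
    simp only [Set.mem_ofPred_eq, Set.mem_image, Finset.coe_range, Set.mem_Iio]
    constructor
    · intro hw
      rw [← Circle.exp_arg w, ← Circle.exp_natCast_mul, Circle.exp_eq_exp] at hw
      obtain ⟨m, hm⟩ := hw
      have hNz : (0 : ℤ) < N := by positivity
      refine ⟨(m % N).toNat, ?_, ?_⟩
      · have := Int.emod_lt_of_pos m hNz
        have := Int.emod_nonneg m hNz.ne'
        lia
      · conv_rhs => rw [← Circle.exp_arg w]
        rw [Circle.exp_eq_exp]
        refine ⟨-(m / N), ?_⟩
        have h1 : (((m % N).toNat : ℕ) : ℝ) = ((m % N : ℤ) : ℝ) := by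
          rw [← Int.cast_natCast, Int.toNat_of_nonneg (Int.emod_nonneg m hNz.ne')]
        have h2 : (m : ℝ) = ((m % N : ℤ) : ℝ) + N * ((m / N : ℤ) : ℝ) := by
          exact_mod_cast (Int.emod_add_mul_ediv m N).symm
        rw [h1, div_eq_iff hN0]
        push_cast
        rw [h2] at hm
        linear_combination -hm
    · rintro ⟨j, _, rfl⟩
      rw [← Circle.exp_natCast_mul, mul_div_cancel₀ _ hN0]
      exact exp_add_two_mul_int_mul_pi x j
  have hinj : Set.InjOn (fun j : ℕ => Circle.exp ((x + 2 * j * Real.pi) / N))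
      (Finset.range N : Set ℕ) := by
    intro i hi j hj hij
    simp only [Finset.coe_range, Set.mem_Iio] at hi hj
    rw [Circle.exp_eq_exp] at hij
    obtain ⟨m, hm⟩ := hij
    have hpi := Real.pi_ne_zero
    have h1 : (i : ℝ) = j + N * m := by
      field_simp at hm
      refine mul_left_cancel₀ hpi ?_
      linear_combination hm / 2
    have h2 : (i : ℤ) - j = N * m := by
      have : (i : ℤ) = j + N * m := by exact_mod_cast h1
      linarith
    have h3 := Int.eq_zero_of_abs_lt_dvd (Dvd.intro m h2.symm : (N : ℤ) ∣ (i : ℤ) - j)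
      (by rw [abs_lt]; constructor <;> lia)
    lia
  rw [hset, finsum_mem_image hinj, finsum_mem_coe_finset]

theorem norm_factor_sq (x : ℝ) (k : ℕ) :
    ‖factor N m₀ x k‖ ^ 2 = ‖m₀ (Circle.exp (x / (N : ℝ) ^ (k + 1)))‖ ^ 2 / N := by
  rw [factor, norm_div, div_pow, Complex.norm_real, Real.norm_of_nonneg (by positivity),
    Real.sq_sqrt (by positivity)]

theorem ruelle_exp (hN : 2 ≤ N) (f : Circle → ℂ) (x : ℝ) :
    ruelle N m₀ m₀ f (Circle.exp x) = ∑ j ∈ Finset.range N,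
      ‖factor N m₀ (x + 2 * j * Real.pi) 0‖ ^ 2 • f (Circle.exp ((x + 2 * j * Real.pi) / N)) := by
  rw [ruelle, finsum_roots_eq hN, Finset.mul_sum]
  refine Finset.sum_congr rfl fun j _ => ?_
  rw [norm_factor_sq, zero_add, pow_one, Complex.conj_mul', Complex.real_smul]
  push_cast
  ring

/-- Dividing 2πN^n l by N^(k+1) leaves an integer multiple of 2π exactly because k + 1 ≤ n. -/
theorem factor_add_period (hN : 2 ≤ N) {k n : ℕ} (hk : k < n) (x : ℝ) (l : ℤ) :
    factor N m₀ (x + 2 * ((N ^ n : ℕ) * l) * Real.pi) k = factor N m₀ x k := by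
  have hN0 : (N : ℝ) ≠ 0 := by positivity
  rw [factor, factor]
  congr 2
  obtain ⟨d, rfl⟩ := Nat.exists_eq_add_of_lt hk
  rw [Circle.exp_eq_exp]
  refine ⟨(N ^ d : ℕ) * l, ?_⟩
  push_cast
  field_simp
  ring

theorem partialWeight_add_period (hN : 2 ≤ N) (n : ℕ) (x : ℝ) (l : ℤ) :
    partialWeight N m₀ n (x + 2 * ((N ^ n : ℕ) * l) * Real.pi) = partialWeight N m₀ n x :=
  Finset.prod_congr rfl fun k hk => by rw [factor_add_period hN (Finset.mem_range.1 hk)]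

theorem partialWeight_succ (n : ℕ) (x : ℝ) :
    partialWeight N m₀ (n + 1) x = partialWeight N m₀ n x * ‖factor N m₀ x n‖ ^ 2 :=
  Finset.prod_range_succ _ _

theorem sum_range_mul_eq {E : Type*} [AddCommMonoid E] (a b : ℕ) (ha : 0 < a) (F : ℕ → E) :
    ∑ j ∈ Finset.range (a * b), F j =
      ∑ j ∈ Finset.range a, ∑ l ∈ Finset.range b, F (j + a * l) := by
  rw [← Finset.sum_product']
  symm
  refine Finset.sum_nbij' (fun p => p.1 + a * p.2) (fun m => (m % a, m / a)) ?_ ?_ ?_ ?_ ?_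
  · rintro ⟨j, l⟩ h
    simp only [Finset.mem_product, Finset.mem_range] at h ⊢
    calc j + a * l < a + a * l := by lia
      _ = a * (l + 1) := by ring
      _ ≤ a * b := Nat.mul_le_mul_left _ h.2
  · intro m hm
    simp only [Finset.mem_product, Finset.mem_range] at hm ⊢
    exact ⟨Nat.mod_lt _ ha, Nat.div_lt_of_lt_mul hm⟩
  · rintro ⟨j, l⟩ h
    simp only [Finset.mem_product, Finset.mem_range] at h
    simp [Nat.mod_eq_of_lt h.1, Nat.add_mul_div_left _ _ ha, Nat.div_eq_of_lt h.1]
  · intro m _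
    exact Nat.mod_add_div m a
  · intros; rfl

theorem iterate_ruelle_exp (hN : 2 ≤ N) (f : Circle → ℂ) (n : ℕ) (x : ℝ) :
    (ruelle N m₀ m₀)^[n] f (Circle.exp x) = ∑ j ∈ Finset.range (N ^ n),
      partialWeight N m₀ n (x + 2 * j * Real.pi) •
        f (Circle.exp ((x + 2 * j * Real.pi) / (N : ℝ) ^ n)) := by
  have hN0 : (N : ℝ) ≠ 0 := by positivity
  induction n generalizing f with
  | zero => simp [partialWeight]
  | succ n ih =>
    -- An index below N^(n+1) is uniquely j + N^n l. The shift by l leaves the first n factors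
    -- unchanged, and the factor of index n is the weight contributed by the innermost application
    -- of R.
    rw [Function.iterate_succ_apply, ih, pow_succ, sum_range_mul_eq _ _ (by positivity)]
    refine Finset.sum_congr rfl fun j _ => ?_
    rw [ruelle_exp hN, Finset.smul_sum]
    refine Finset.sum_congr rfl fun l _ => ?_
    have h1 : (x + 2 * ((j + N ^ n * l : ℕ) : ℝ) * Real.pi) =
        (x + 2 * j * Real.pi) + 2 * ((N ^ n : ℕ) * (l : ℤ)) * Real.pi := by
      push_cast; ring
    have h2 : (x + 2 * j * Real.pi) / (N : ℝ) ^ n + 2 * l * Real.pi =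
        ((x + 2 * j * Real.pi) + 2 * ((N ^ n : ℕ) * (l : ℤ)) * Real.pi) / (N : ℝ) ^ n := by
      push_cast; field_simp
    rw [h1, partialWeight_succ, partialWeight_add_period hN, smul_smul, h2, div_div, ← pow_succ]
    congr 3
    rw [factor, factor, zero_add, div_div, pow_one, ← pow_succ]

/-- The iterates of the Ruelle operator as sums over any window of `N ^ n` consecutive
translates. -/
theorem iterate_ruelle_exp_Ico (hN : 2 ≤ N) (f : Circle → ℂ) (n : ℕ) (x : ℝ) (a : ℤ) :
    (ruelle N m₀ m₀)^[n] f (Circle.exp x) = ∑ j ∈ Finset.Ico a (a + (N ^ n : ℕ)),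
      partialWeight N m₀ n (x + 2 * j * Real.pi) •
        f (Circle.exp ((x + 2 * j * Real.pi) / (N : ℝ) ^ n)) := by
  have hN0 : (N : ℝ) ≠ 0 := by positivity
  rw [iterate_ruelle_exp hN, ← sum_range_eq_sum_Ico_of_periodic (by positivity)]
  · simp
  · intro j
    have h1 : x + 2 * ((j + (N ^ n : ℕ) : ℤ) : ℝ) * Real.pi =
        (x + 2 * j * Real.pi) + 2 * ((N ^ n : ℕ) * (1 : ℤ)) * Real.pi := by
      push_cast; ring
    have h2 : ((x + 2 * j * Real.pi) + 2 * ((N ^ n : ℕ) * (1 : ℤ)) * Real.pi) / (N : ℝ) ^ n =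
        (x + 2 * j * Real.pi) / (N : ℝ) ^ n + 2 * (1 : ℤ) * Real.pi := by
      push_cast; field_simp
    rw [h1, partialWeight_add_period hN, h2, exp_add_two_mul_int_mul_pi]

theorem iterate_ruelle_ofReal (hN : 2 ≤ N) (f : Circle → ℝ) (n : ℕ) (x : ℝ) (a : ℤ) :
    (ruelle N m₀ m₀)^[n] (fun w => (f w : ℂ)) (Circle.exp x) =
      ((∑ j ∈ Finset.Ico a (a + (N ^ n : ℕ)), partialWeight N m₀ n (x + 2 * j * Real.pi) *
        f (Circle.exp ((x + 2 * j * Real.pi) / (N : ℝ) ^ n)) : ℝ) : ℂ) := by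
  rw [iterate_ruelle_exp_Ico hN _ n x a]
  push_cast
  simp [Complex.real_smul]

theorem IsRuelleFixed.iterate {h : Circle → ℝ} (hh : IsRuelleFixed N m₀ h) (n : ℕ) :
    (ruelle N m₀ m₀)^[n] (fun w => (h w : ℂ)) = fun w => (h w : ℂ) :=
  Function.iterate_fixed (funext hh) n

/-- Writes a fixed point as a weighted average of its own values at every level n, so that fixed
points can be compared term by term with truncated averages. -/
theorem IsRuelleFixed.sum_eq (hN : 2 ≤ N) {h : Circle → ℝ} (hh : IsRuelleFixed N m₀ h)
    (n : ℕ) (x : ℝ) (a : ℤ) :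
    ∑ j ∈ Finset.Ico a (a + (N ^ n : ℕ)), partialWeight N m₀ n (x + 2 * j * Real.pi) *
        h (Circle.exp ((x + 2 * j * Real.pi) / (N : ℝ) ^ n)) = h (Circle.exp x) := by
  have h1 := iterate_ruelle_ofReal (m₀ := m₀) hN h n x a
  rw [hh.iterate] at h1
  exact (Complex.ofReal_injective h1).symm

theorem isRuelleFixed_one (hR : ∀ z, ruelle N m₀ m₀ (fun _ => 1) z = 1) :
    IsRuelleFixed N m₀ fun _ => 1 := by
  intro z
  simpa using hR z

theorem sum_partialWeight_eq_one (hN : 2 ≤ N) (hR : ∀ z, ruelle N m₀ m₀ (fun _ => 1) z = 1)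
    (n : ℕ) (x : ℝ) (a : ℤ) :
    ∑ j ∈ Finset.Ico a (a + (N ^ n : ℕ)), partialWeight N m₀ n (x + 2 * j * Real.pi) = 1 := by
  simpa using (isRuelleFixed_one hR).sum_eq hN n x a

end Iterates

/-! ### The limit of the iterates, bump functions and Lipschitz estimates. -/

section Limit

open Filter Topology

variable {N : ℕ} {m₀ : Circle → ℂ} {K : NNReal}

/-- The integers `j` with `-π ≤ (x + 2jπ) / N ^ n < π`. -/
noncomputable def window (N : ℕ) (x : ℝ) (n : ℕ) : Finset ℤ :=
  Finset.Ico ⌈-(N : ℝ) ^ n / 2 - x / (2 * Real.pi)⌉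
    (⌈-(N : ℝ) ^ n / 2 - x / (2 * Real.pi)⌉ + (N ^ n : ℕ))

theorem abs_le_pi_of_mem_window (hN : 2 ≤ N) {x : ℝ} {n : ℕ} {j : ℤ} (hj : j ∈ window N x n) :
    |(x + 2 * j * Real.pi) / (N : ℝ) ^ n| ≤ Real.pi := by
  have hpi := Real.pi_pos
  rw [window, Finset.mem_Ico] at hj
  have h1 : -(N : ℝ) ^ n / 2 - x / (2 * Real.pi) ≤ j := Int.ceil_le.1 hj.1
  have h2 : (j : ℝ) < (N : ℝ) ^ n / 2 - x / (2 * Real.pi) := by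
    -- For an integer, lying strictly below the ceiling is the same as lying strictly below the real
    -- number itself, so no rounding error enters the upper bound.
    have h3 : (j - (N ^ n : ℕ) : ℤ) < ⌈-(N : ℝ) ^ n / 2 - x / (2 * Real.pi)⌉ := by linarith [hj.2]
    have h4 := Int.lt_ceil.1 h3
    push_cast at h4
    linarith
  have hx : x / (2 * Real.pi) * (2 * Real.pi) = x := by field_simp
  rw [abs_div, abs_of_pos (show (0 : ℝ) < (N : ℝ) ^ n by positivity), div_le_iff₀ (by positivity),
    abs_le]
  constructor <;> nlinarith

theorem eventually_mem_window (hN : 2 ≤ N) (x : ℝ) (j : ℤ) : ∀ᶠ n in atTop, j ∈ window N x n := by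
  have h : Tendsto (fun n : ℕ => (N : ℝ) ^ n) atTop atTop :=
    tendsto_pow_atTop_atTop_of_one_lt (by exact_mod_cast (by omega : 1 < N))
  filter_upwards [h.eventually_ge_atTop (2 * (|(j : ℝ)| + |x / (2 * Real.pi)| + 1))] with n hn
  have h1 := abs_le.1 (le_refl |(j : ℝ)|)
  have h2 := abs_le.1 (le_refl |x / (2 * Real.pi)|)
  rw [window, Finset.mem_Ico]
  constructor
  · rw [Int.ceil_le]; linarith
  · have h3 : (j - (N ^ n : ℕ) : ℤ) < ⌈-(N : ℝ) ^ n / 2 - x / (2 * Real.pi)⌉ := by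
      rw [Int.lt_ceil]; push_cast; linarith
    linarith

/-- A Fatou argument: a finite set of translates eventually lies in the window, where the partial
weights have total mass 1. -/
theorem sum_norm_scalingFunction_sq_le_one (hN : 2 ≤ N) (hLip : LipschitzWith K m₀)
    (hone : m₀ 1 = ((√(N : ℝ) : ℝ) : ℂ)) (hR : ∀ z, ruelle N m₀ m₀ (fun _ => 1) z = 1)
    (x : ℝ) (F : Finset ℤ) :
    ∑ j ∈ F, ‖scalingFunction N m₀ (x + 2 * j * Real.pi)‖ ^ 2 ≤ 1 := by
  refine le_of_tendsto (tendsto_finsetSum F fun j _ =>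
    tendsto_partialWeight hN hLip hone (x + 2 * j * Real.pi)) ?_
  filter_upwards [(eventually_all_finset F).2 fun j _ => eventually_mem_window hN x j] with n hn
  rw [← sum_partialWeight_eq_one hN hR n x ⌈-(N : ℝ) ^ n / 2 - x / (2 * Real.pi)⌉]
  exact Finset.sum_le_sum_of_subset_of_nonneg hn fun _ _ _ => partialWeight_nonneg _ _

theorem summable_norm_scalingFunction_sq (hN : 2 ≤ N) (hLip : LipschitzWith K m₀)
    (hone : m₀ 1 = ((√(N : ℝ) : ℝ) : ℂ)) (hR : ∀ z, ruelle N m₀ m₀ (fun _ => 1) z = 1) (x : ℝ) :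
    Summable fun j : ℤ => ‖scalingFunction N m₀ (x + 2 * j * Real.pi)‖ ^ 2 :=
  summable_of_sum_le (fun _ => by positivity) (sum_norm_scalingFunction_sq_le_one hN hLip hone hR x)

theorem hasSum_hFunction (hN : 2 ≤ N) (hLip : LipschitzWith K m₀)
    (hone : m₀ 1 = ((√(N : ℝ) : ℝ) : ℂ)) (hR : ∀ z, ruelle N m₀ m₀ (fun _ => 1) z = 1) (x : ℝ) :
    HasSum (fun k : ℤ => ‖scalingFunction N m₀ (x + 2 * k * Real.pi)‖ ^ 2)
      (hFunction N m₀ (Circle.exp x)) := by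
  -- `hFunction` is evaluated at the argument of the point, which differs from x by 2πm; the series
  -- is reindexed by k ↦ k + m.
  obtain ⟨m, hm⟩ := Circle.exp_eq_exp.1 (Circle.exp_arg (Circle.exp x))
  rw [hFunction, periodization, hm]
  convert! (summable_norm_scalingFunction_sq hN hLip hone hR x).hasSum using 1
  rw [← (Equiv.addRight m).tsum_eq
    fun k : ℤ => ‖scalingFunction N m₀ (x + 2 * k * Real.pi)‖ ^ 2]
  refine tsum_congr fun k => ?_
  congr 3
  simp only [Equiv.coe_addRight]
  push_cast
  ring

theorem hFunction_nonneg (z : Circle) : 0 ≤ hFunction N m₀ z :=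
  tsum_nonneg fun _ => by positivity

/-- The iterates of the Ruelle operator on a function concentrated near `1` converge to a multiple
of `h_{m₀,1}`. -/
theorem tendsto_iterate_ruelle (hN : 2 ≤ N) (hLip : LipschitzWith K m₀)
    (hone : m₀ 1 = ((√(N : ℝ) : ℝ) : ℂ)) (hR : ∀ z, ruelle N m₀ m₀ (fun _ => 1) z = 1)
    {ε : ℝ} (hφ : ∀ x : ℝ, |x| < ε → 1 / 2 ≤ ‖scalingFunction N m₀ x‖ ^ 2)
    {f : Circle → ℂ} (hf : Continuous f)
    (hsupp : ∀ t : ℝ, |t| ≤ Real.pi → ε ≤ |t| → f (Circle.exp t) = 0) (z : Circle) :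
    Tendsto (fun n => (ruelle N m₀ m₀)^[n] f z) atTop (𝓝 (hFunction N m₀ z * f 1)) := by
  classical
  obtain ⟨x, rfl⟩ := Circle.exp_surjective z
  obtain ⟨C, hC⟩ := isCompact_univ.exists_bound_of_continuousOn hf.continuousOn
  have hC0 : 0 ≤ C := (norm_nonneg _).trans (hC 1 (Set.mem_univ _))
  have hsum := hasSum_hFunction hN hLip hone hR x
  -- Extension by zero outside the window turns sums over growing finite sets into series over ℤ, so
  -- that dominated convergence applies.
  set F : ℕ → ℤ → ℂ := fun n j => if j ∈ window N x n then
    partialWeight N m₀ n (x + 2 * j * Real.pi) •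
      f (Circle.exp ((x + 2 * j * Real.pi) / (N : ℝ) ^ n)) else 0 with hF
  have h1 : (fun n => (ruelle N m₀ m₀)^[n] f (Circle.exp x)) = fun n => ∑' j, F n j := by
    funext n
    rw [tsum_eq_sum (s := window N x n) fun j hj => by simp only [hF, if_neg hj]]
    exact (iterate_ruelle_exp_Ico hN f n x _).trans
      (Finset.sum_congr rfl fun j hj => (by simp only [hF]; rw [if_pos hj]))
  have h2 : (hFunction N m₀ (Circle.exp x) * f 1 : ℂ) =
      ∑' j : ℤ, ‖scalingFunction N m₀ (x + 2 * j * Real.pi)‖ ^ 2 • f 1 := by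
    rw [(hsum.smul_const (f 1)).tsum_eq, Complex.real_smul]
  rw [h1, h2]
  refine tendsto_tsum_of_dominated_convergence
    -- C bounds |f|, and the 2 inverts the lower bound 1/2 for |φ|² near 0. Terms with (x+2jπ)/N^n
    -- outside that neighbourhood vanish by the support condition.
    (bound := fun j : ℤ => 2 * C * ‖scalingFunction N m₀ (x + 2 * j * Real.pi)‖ ^ 2)
    (hsum.summable.mul_left _) (fun j => ?_) (Eventually.of_forall fun n j => ?_)
  · have h3 : Tendsto (fun n : ℕ => (x + 2 * j * Real.pi) / (N : ℝ) ^ n) atTop (𝓝 0) :=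
      tendsto_const_nhds.div_atTop
        (tendsto_pow_atTop_atTop_of_one_lt (by exact_mod_cast (by omega : 1 < N)))
    have h4 : Tendsto (fun n : ℕ => f (Circle.exp ((x + 2 * j * Real.pi) / (N : ℝ) ^ n))) atTop
        (𝓝 (f 1)) := by
      have := ((hf.comp Circle.exp.continuous).tendsto 0).comp h3
      simpa using! this
    refine ((tendsto_partialWeight hN hLip hone (x + 2 * j * Real.pi)).smul h4).congr' ?_
    filter_upwards [eventually_mem_window hN x j] with n hn
    simp only [hF, if_pos hn]
  · simp only [hF]
    split_ifs with hj
    · rw [norm_smul, Real.norm_of_nonneg (partialWeight_nonneg _ _)]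
      by_cases ht : |(x + 2 * j * Real.pi) / (N : ℝ) ^ n| < ε
      · rw [norm_scalingFunction_sq_eq hN hLip hone _ n]
        have h5 := hφ _ ht
        have h6 := hC (Circle.exp ((x + 2 * j * Real.pi) / (N : ℝ) ^ n)) (Set.mem_univ _)
        have h7 := partialWeight_nonneg (N := N) (m₀ := m₀) n (x + 2 * j * Real.pi)
        calc _ ≤ partialWeight N m₀ n (x + 2 * j * Real.pi) * C := by gcongr
          _ = 2 * C * (partialWeight N m₀ n (x + 2 * j * Real.pi) * (1 / 2)) := by ring
          _ ≤ _ := by gcongr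
      · rw [hsupp _ (abs_le_pi_of_mem_window hN hj) (not_lt.1 ht), norm_zero, mul_zero]
        positivity
    · rw [norm_zero]; positivity

/-- A Lipschitz bump function at `1`. -/
noncomputable def bump (δ : ℝ) (z : Circle) : ℝ := max 0 (1 - dist z 1 / δ)

theorem continuous_bump (δ : ℝ) : Continuous (bump δ) := by
  unfold bump; fun_prop

theorem bump_one (δ : ℝ) : bump δ 1 = 1 := by simp [bump]

theorem bump_nonneg (δ : ℝ) (z : Circle) : 0 ≤ bump δ z := le_max_left _ _

theorem bump_le_one {δ : ℝ} (hδ : 0 < δ) (z : Circle) : bump δ z ≤ 1 :=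
  max_le zero_le_one (by have : 0 ≤ dist z 1 / δ := by positivity
                         linarith)

/-- The chord has length 2|sin(t/2)|, and Jordan's inequality bounds the sine below. -/
theorem abs_le_dist_exp_one {t : ℝ} (ht : |t| ≤ Real.pi) :
    2 / Real.pi * |t| ≤ dist (Circle.exp t) 1 := by
  change _ ≤ dist (Circle.exp t : ℂ) 1
  rw [dist_eq_norm, Circle.coe_exp, mul_comm (t : ℂ), Complex.norm_exp_I_mul_ofReal_sub_one,
    norm_mul, Real.norm_eq_abs, Real.norm_eq_abs, abs_two]
  have h := Real.mul_abs_le_abs_sin (x := t / 2) (by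
    rw [abs_div, abs_two]; linarith)
  rw [abs_div, abs_two] at h
  linarith

theorem bump_exp_eq_zero {ε : ℝ} (hε : 0 < ε) {t : ℝ} (ht : |t| ≤ Real.pi) (hεt : ε ≤ |t|) :
    bump (2 / Real.pi * ε) (Circle.exp t) = 0 := by
  have hpi := Real.pi_pos
  refine max_eq_left ?_
  rw [sub_nonpos, one_le_div (by positivity)]
  exact le_trans (by gcongr) (abs_le_dist_exp_one ht)

theorem abs_bump_exp_sub_le {δ : ℝ} (hδ : 0 < δ) (x y : ℝ) :
    |bump δ (Circle.exp x) - bump δ (Circle.exp y)| ≤ δ⁻¹ * |x - y| := by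
  refine (abs_max_sub_max_le_max _ _ _ _).trans (max_le (by simp; positivity) ?_)
  have h : 1 - dist (Circle.exp x) 1 / δ - (1 - dist (Circle.exp y) 1 / δ) =
      δ⁻¹ * (dist (Circle.exp y) 1 - dist (Circle.exp x) 1) := by field_simp; ring
  rw [h, abs_mul, abs_of_pos (inv_pos.2 hδ), abs_sub_comm]
  exact mul_le_mul_of_nonneg_left ((abs_dist_sub_le _ _ _).trans (dist_exp_le x y)) (by positivity)

theorem sum_norm_factor_sq (hN : 2 ≤ N) (hR : ∀ z, ruelle N m₀ m₀ (fun _ => 1) z = 1) (x : ℝ) :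
    ∑ j ∈ Finset.range N, ‖factor N m₀ (x + 2 * j * Real.pi) 0‖ ^ 2 = 1 := by
  have h := hR (Circle.exp x)
  rw [ruelle_exp hN] at h
  simp only [Complex.real_smul, mul_one] at h
  exact_mod_cast h

theorem norm_le_sqrt (hN : 2 ≤ N) (hR : ∀ z, ruelle N m₀ m₀ (fun _ => 1) z = 1) (z : Circle) :
    ‖m₀ z‖ ≤ √(N : ℝ) := by
  have hN0 : (N : ℝ) ≠ 0 := by positivity
  obtain ⟨t, rfl⟩ := Circle.exp_surjective z
  -- Over the point e^{iNt}, the root of index 0 is e^{it}; its weight is one term of a nonnegative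
  -- sum equal to 1.
  have h := sum_norm_factor_sq hN hR (N * t)
  have h1 : ‖factor N m₀ (N * t + 2 * (0 : ℕ) * Real.pi) 0‖ ^ 2 ≤ 1 := by
    rw [← h]
    exact Finset.single_le_sum (f := fun j : ℕ => ‖factor N m₀ (N * t + 2 * j * Real.pi) 0‖ ^ 2)
      (fun _ _ => by positivity) (Finset.mem_range.2 (by omega))
  have ht : (N * t + 2 * (0 : ℕ) * Real.pi) / (N : ℝ) ^ (0 + 1) = t := by
    simp [mul_div_cancel_left₀ _ hN0]
  rw [norm_factor_sq, div_le_one (by positivity), ht] at h1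
  exact Real.le_sqrt_of_sq_le h1

theorem norm_ruelle_le_one (hN : 2 ≤ N) (hR : ∀ z, ruelle N m₀ m₀ (fun _ => 1) z = 1)
    {f : Circle → ℂ} (hf : ∀ z, ‖f z‖ ≤ 1) (z : Circle) : ‖ruelle N m₀ m₀ f z‖ ≤ 1 := by
  obtain ⟨x, rfl⟩ := Circle.exp_surjective z
  rw [ruelle_exp hN, ← sum_norm_factor_sq hN hR x]
  refine norm_sum_le_of_le _ fun j _ => ?_
  rw [norm_smul, Real.norm_of_nonneg (by positivity)]
  exact mul_le_of_le_one_right (by positivity) (hf _)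

/-- One factor 1/N is the normalization of the weight, the other the contraction x ↦ x/N; 2√N bounds
the sum of the two moduli in the difference of squares. -/
theorem abs_norm_factor_sq_sub_le (hN : 2 ≤ N) (hLip : LipschitzWith K m₀)
    (hR : ∀ z, ruelle N m₀ m₀ (fun _ => 1) z = 1) (x y : ℝ) :
    |‖factor N m₀ x 0‖ ^ 2 - ‖factor N m₀ y 0‖ ^ 2| ≤ 2 * √(N : ℝ) * K * |x - y| / N ^ 2 := by
  have hN0 : (0 : ℝ) < N := by positivity
  rw [norm_factor_sq, norm_factor_sq, zero_add, pow_one, ← sub_div, sq_sub_sq, abs_div, abs_mul,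
    abs_of_pos hN0]
  have h1 := norm_le_sqrt hN hR (Circle.exp (x / N))
  have h2 := norm_le_sqrt hN hR (Circle.exp (y / N))
  have h3 : |‖m₀ (Circle.exp (x / N))‖ + ‖m₀ (Circle.exp (y / N))‖| ≤ 2 * √(N : ℝ) := by
    rw [abs_of_nonneg (by positivity)]; linarith
  have h4 : |‖m₀ (Circle.exp (x / N))‖ - ‖m₀ (Circle.exp (y / N))‖| ≤ K * (|x - y| / N) := by
    refine (abs_norm_sub_norm_le _ _).trans ?_
    rw [← dist_eq_norm]
    refine (hLip.dist_le_mul _ _).trans ?_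
    gcongr
    refine (dist_exp_le _ _).trans ?_
    rw [← sub_div, abs_div, abs_of_pos hN0]
  calc _ ≤ (2 * √(N : ℝ)) * (K * (|x - y| / N)) / N := by gcongr
    _ = _ := by field_simp

/-- In the unit ball, R preserves every Lipschitz bound L ≥ 2√N K. The variation of f contributes
L/N after averaging, the variation of the N weights contributes N · L/N², and 2L/N ≤ L because N ≥
2. -/
theorem norm_ruelle_sub_le (hN : 2 ≤ N) (hLip : LipschitzWith K m₀)
    (hR : ∀ z, ruelle N m₀ m₀ (fun _ => 1) z = 1) {L : ℝ} (hL : 2 * √(N : ℝ) * K ≤ L)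
    {f : Circle → ℂ} (hf : ∀ z, ‖f z‖ ≤ 1)
    (hfL : ∀ x y : ℝ, ‖f (Circle.exp x) - f (Circle.exp y)‖ ≤ L * |x - y|) (x y : ℝ) :
    ‖ruelle N m₀ m₀ f (Circle.exp x) - ruelle N m₀ m₀ f (Circle.exp y)‖ ≤ L * |x - y| := by
  have hN0 : (0 : ℝ) < N := by positivity
  have hL0 : 0 ≤ L := le_trans (by positivity) hL
  have h2N : (2 : ℝ) ≤ N := by exact_mod_cast hN
  rw [ruelle_exp hN, ruelle_exp hN, ← Finset.sum_sub_distrib]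
  have hterm : ∀ j ∈ Finset.range N,
      ‖‖factor N m₀ (x + 2 * j * Real.pi) 0‖ ^ 2 • f (Circle.exp ((x + 2 * j * Real.pi) / N)) -
        ‖factor N m₀ (y + 2 * j * Real.pi) 0‖ ^ 2 • f (Circle.exp ((y + 2 * j * Real.pi) / N))‖ ≤
      ‖factor N m₀ (x + 2 * j * Real.pi) 0‖ ^ 2 * (L * (|x - y| / N)) + L * |x - y| / N ^ 2 := by
    intro j _
    set a := ‖factor N m₀ (x + 2 * j * Real.pi) 0‖ ^ 2
    set b := ‖factor N m₀ (y + 2 * j * Real.pi) 0‖ ^ 2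
    set p := f (Circle.exp ((x + 2 * j * Real.pi) / N))
    set q := f (Circle.exp ((y + 2 * j * Real.pi) / N))
    have ha : 0 ≤ a := by positivity
    have h1 : a • p - b • q = a • (p - q) + (a - b) • q := by module
    have h2 : ‖p - q‖ ≤ L * (|x - y| / N) := by
      refine (hfL _ _).trans ?_
      rw [← sub_div, abs_div, abs_of_pos hN0, add_sub_add_right_eq_sub]
    have h3 : |a - b| ≤ L * |x - y| / N ^ 2 := by
      refine (abs_norm_factor_sq_sub_le hN hLip hR _ _).trans ?_
      rw [add_sub_add_right_eq_sub]
      gcongr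
    rw [h1]
    refine (norm_add_le _ _).trans (add_le_add ?_ ?_)
    · rw [norm_smul, Real.norm_of_nonneg ha]
      gcongr
    · rw [norm_smul, Real.norm_eq_abs]
      exact (mul_le_of_le_one_right (abs_nonneg _) (hf _)).trans h3
  refine (norm_sum_le_of_le _ hterm).trans ?_
  rw [Finset.sum_add_distrib, ← Finset.sum_mul, sum_norm_factor_sq hN hR, one_mul,
    Finset.sum_const, Finset.card_range, nsmul_eq_mul]
  calc L * (|x - y| / N) + N * (L * |x - y| / N ^ 2) = L * |x - y| * (2 / N) := by
        field_simp; ring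
    _ ≤ L * |x - y| * 1 := by
        gcongr
        rw [div_le_one hN0]; exact h2N
    _ = _ := mul_one _

/-- Passes from arc length to the chordal metric of the circle, at the cost of a factor π/2. -/
theorem lipschitzWith_of_abs_exp_sub_le {h : Circle → ℝ} {L : ℝ} (hL : 0 ≤ L)
    (hh : ∀ x y : ℝ, |h (Circle.exp x) - h (Circle.exp y)| ≤ L * |x - y|) :
    LipschitzWith ⟨L * (Real.pi / 2), by have := Real.pi_pos; positivity⟩ h := by
  have hpi := Real.pi_pos
  refine LipschitzWith.of_dist_le_mul fun z w => ?_
  obtain ⟨y, rfl⟩ := Circle.exp_surjective w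
  set t : ℝ := Complex.arg (z / Circle.exp y : Circle) with ht
  have hz : z = Circle.exp (y + t) := by
    rw [Circle.exp_add, ht, Circle.exp_arg, mul_div_cancel]
  have ht2 : 2 / Real.pi * |t| ≤ dist z (Circle.exp y) := by
    have h1 := abs_le_dist_exp_one (t := t) (Complex.abs_arg_le_pi _)
    rw [hz, Circle.exp_add]
    convert h1 using 1
    change dist ((Circle.exp y : ℂ) * (Circle.exp t : ℂ)) (Circle.exp y : ℂ) =
      dist (Circle.exp t : ℂ) 1
    rw [dist_eq_norm, dist_eq_norm, ← mul_sub_one, norm_mul, Circle.norm_coe, one_mul]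
  have h2 := hh (y + t) y
  rw [← hz, add_sub_cancel_left] at h2
  rw [Real.dist_eq]
  refine h2.trans ?_
  change _ ≤ L * (Real.pi / 2) * dist z (Circle.exp y)
  have h3 : |t| ≤ Real.pi / 2 * dist z (Circle.exp y) := by
    calc |t| = Real.pi / 2 * (2 / Real.pi * |t|) := by field_simp
      _ ≤ _ := by gcongr
  calc _ ≤ L * (Real.pi / 2 * dist z (Circle.exp y)) := by gcongr
    _ = _ := by ring

end Limit

/-! ### The fixed point: comparison, regularity, minimality and cycles. -/

section FixedPoint

open Filter Topology

variable {N : ℕ} {m₀ : Circle → ℂ} {K : NNReal}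

/-- There is a bump function which localizes the iterates of the Ruelle operator at `1`. -/
theorem exists_bump_tendsto (hN : 2 ≤ N) (hLip : LipschitzWith K m₀)
    (hone : m₀ 1 = ((√(N : ℝ) : ℝ) : ℂ)) (hR : ∀ z, ruelle N m₀ m₀ (fun _ => 1) z = 1) :
    ∃ δ > 0, ∀ f : Circle → ℝ, Continuous f → ∀ z,
      Tendsto (fun n => (ruelle N m₀ m₀)^[n] (fun w => ((bump δ w * f w : ℝ) : ℂ)) z) atTop
        (𝓝 ((hFunction N m₀ z * f 1 : ℝ) : ℂ)) := by
  obtain ⟨ε, hε, hφ⟩ := exists_half_le_norm_scalingFunction_sq hN hLip hone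
  refine ⟨2 / Real.pi * ε, by have := Real.pi_pos; positivity, fun f hf z => ?_⟩
  have h := tendsto_iterate_ruelle hN hLip hone hR hφ
    (f := fun w => ((bump (2 / Real.pi * ε) w * f w : ℝ) : ℂ))
    (Complex.continuous_ofReal.comp ((continuous_bump _).mul hf))
    (fun t ht hεt => by rw [bump_exp_eq_zero hε ht hεt]; simp) z
  simpa [bump_one] using h

theorem exists_bump_tendsto_sum (hN : 2 ≤ N) (hLip : LipschitzWith K m₀)
    (hone : m₀ 1 = ((√(N : ℝ) : ℝ) : ℂ)) (hR : ∀ z, ruelle N m₀ m₀ (fun _ => 1) z = 1) :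
    ∃ δ > 0, ∀ f : Circle → ℝ, Continuous f → ∀ x : ℝ,
      Tendsto (fun n => ∑ j ∈ Finset.Ico (0 : ℤ) (0 + (N ^ n : ℕ)),
        partialWeight N m₀ n (x + 2 * j * Real.pi) *
          (bump δ (Circle.exp ((x + 2 * j * Real.pi) / (N : ℝ) ^ n)) *
            f (Circle.exp ((x + 2 * j * Real.pi) / (N : ℝ) ^ n)))) atTop
        (𝓝 (hFunction N m₀ (Circle.exp x) * f 1)) := by
  obtain ⟨δ, hδ, h⟩ := exists_bump_tendsto hN hLip hone hR
  refine ⟨δ, hδ, fun f hf x => ?_⟩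
  have h1 := h f hf (Circle.exp x)
  simp_rw [iterate_ruelle_ofReal hN (fun w => bump δ w * f w) _ x 0] at h1
  exact Complex.continuous_re.continuousAt.tendsto.comp h1

/-- By positivity, R^n of the truncation of h by the bump is at most R^n h = h, while it tends to
h(1) times the periodized function. -/
theorem hFunction_le_of_isRuelleFixed (hN : 2 ≤ N) (hLip : LipschitzWith K m₀)
    (hone : m₀ 1 = ((√(N : ℝ) : ℝ) : ℂ)) (hR : ∀ z, ruelle N m₀ m₀ (fun _ => 1) z = 1)
    {h : Circle → ℝ} (hc : Continuous h) (h0 : ∀ z, 0 ≤ h z) (hh : IsRuelleFixed N m₀ h)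
    (h1 : h 1 = 1) (z : Circle) : hFunction N m₀ z ≤ h z := by
  obtain ⟨x, rfl⟩ := Circle.exp_surjective z
  obtain ⟨δ, hδ, hlim⟩ := exists_bump_tendsto_sum hN hLip hone hR
  have h2 := hlim h hc x
  rw [h1, mul_one] at h2
  refine le_of_tendsto' h2 fun n => ?_
  rw [← hh.sum_eq hN n x 0]
  refine Finset.sum_le_sum fun j _ => mul_le_mul_of_nonneg_left ?_ (partialWeight_nonneg _ _)
  exact mul_le_of_le_one_left (h0 _) (bump_le_one hδ _)

/-- The upper bound compares with the constant fixed point 1; the lower bound is the term k = 0 of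
the series, since φ(0) = 1. -/
theorem hFunction_one (hN : 2 ≤ N) (hLip : LipschitzWith K m₀)
    (hone : m₀ 1 = ((√(N : ℝ) : ℝ) : ℂ)) (hR : ∀ z, ruelle N m₀ m₀ (fun _ => 1) z = 1) :
    hFunction N m₀ 1 = 1 := by
  refine le_antisymm (hFunction_le_of_isRuelleFixed hN hLip hone hR continuous_const
    (fun _ => zero_le_one) (isRuelleFixed_one hR) rfl 1) ?_
  have h := (hasSum_hFunction hN hLip hone hR 0).summable.le_tsum 0 fun _ _ => by positivity
  rw [(hasSum_hFunction hN hLip hone hR 0).tsum_eq] at h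
  simpa [scalingFunction_zero hN hone] using h

theorem exists_lipschitzWith_hFunction (hN : 2 ≤ N) (hLip : LipschitzWith K m₀)
    (hone : m₀ 1 = ((√(N : ℝ) : ℝ) : ℂ)) (hR : ∀ z, ruelle N m₀ m₀ (fun _ => 1) z = 1) :
    ∃ L, LipschitzWith L (hFunction N m₀) := by
  obtain ⟨δ, hδ, hlim⟩ := exists_bump_tendsto hN hLip hone hR
  -- The first entry makes the bound stable under R, the second makes it valid for the bump itself;
  -- a bound uniform in n survives the pointwise limit.
  set L : ℝ := max (2 * √(N : ℝ) * K) δ⁻¹ with hL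
  have hL0 : 0 ≤ L := le_trans (by positivity) (le_max_left _ _)
  set g : Circle → ℂ := fun w => ((bump δ w * 1 : ℝ) : ℂ) with hg
  have hiter : ∀ n, (∀ z, ‖(ruelle N m₀ m₀)^[n] g z‖ ≤ 1) ∧ ∀ x y : ℝ,
      ‖(ruelle N m₀ m₀)^[n] g (Circle.exp x) - (ruelle N m₀ m₀)^[n] g (Circle.exp y)‖ ≤
        L * |x - y| := by
    intro n
    induction n with
    | zero =>
      refine ⟨fun z => ?_, fun x y => ?_⟩
      · simp only [Function.iterate_zero, id, hg, mul_one, Complex.norm_real,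
          Real.norm_of_nonneg (bump_nonneg _ _)]
        exact bump_le_one hδ z
      · simp only [Function.iterate_zero, id, hg, mul_one]
        rw [← Complex.ofReal_sub, Complex.norm_real]
        refine (abs_bump_exp_sub_le hδ x y).trans ?_
        gcongr
        exact le_max_right _ _
    | succ n ih =>
      rw [Function.iterate_succ_apply']
      exact ⟨norm_ruelle_le_one hN hR ih.1,
        norm_ruelle_sub_le hN hLip hR (le_max_left _ _) ih.1 ih.2⟩
  refine ⟨_, lipschitzWith_of_abs_exp_sub_le hL0 fun x y => ?_⟩
  have h1 := hlim (fun _ => 1) continuous_const (Circle.exp x)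
  have h2 := hlim (fun _ => 1) continuous_const (Circle.exp y)
  have h3 := le_of_tendsto' (h1.sub h2).norm fun n => (hiter n).2 x y
  rw [← Complex.ofReal_sub, Complex.norm_real] at h3
  simpa using h3

/-- R is a finite sum at each point, hence passes through pointwise limits; the shifted sequence of
iterates has the same limit. -/
theorem isRuelleFixed_hFunction (hN : 2 ≤ N) (hLip : LipschitzWith K m₀)
    (hone : m₀ 1 = ((√(N : ℝ) : ℝ) : ℂ)) (hR : ∀ z, ruelle N m₀ m₀ (fun _ => 1) z = 1) :
    IsRuelleFixed N m₀ (hFunction N m₀) := by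
  obtain ⟨δ, hδ, hlim⟩ := exists_bump_tendsto hN hLip hone hR
  have h1 := hlim (fun _ => 1) continuous_const
  simp only [mul_one] at h1
  intro z
  refine tendsto_nhds_unique ?_ ((h1 z).comp (tendsto_add_atTop_nat 1))
  obtain ⟨x, rfl⟩ := Circle.exp_surjective z
  simp only [Function.comp_def, Function.iterate_succ_apply', ruelle_exp hN]
  exact tendsto_finsetSum _ fun j _ => (h1 _).const_smul _

theorem eq_mul_hFunction_of_le (hN : 2 ≤ N) (hLip : LipschitzWith K m₀)
    (hone : m₀ 1 = ((√(N : ℝ) : ℝ) : ℂ)) (hR : ∀ z, ruelle N m₀ m₀ (fun _ => 1) z = 1)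
    {h' : Circle → ℝ} {c : ℝ} (hc : Continuous h')
    (hle : ∀ z, 0 ≤ h' z ∧ h' z ≤ c * hFunction N m₀ z) (hh : IsRuelleFixed N m₀ h')
    (z : Circle) : h' z = h' 1 * hFunction N m₀ z := by
  obtain ⟨x, rfl⟩ := Circle.exp_surjective z
  obtain ⟨L, hL⟩ := exists_lipschitzWith_hFunction hN hLip hone hR
  obtain ⟨δ, hδ, hlim⟩ := exists_bump_tendsto_sum hN hLip hone hR
  have h1 := (hlim h' hc x).const_sub (h' (Circle.exp x))
  have h2 := ((hlim _ hL.continuous x).const_sub (hFunction N m₀ (Circle.exp x))).const_mul c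
  -- Because h(1) = 1, the mass of h away from 1 vanishes in the limit. By domination the
  -- corresponding mass of h' vanishes too.
  rw [hFunction_one hN hLip hone hR, mul_one, sub_self, mul_zero] at h2
  have hb : ∀ w, 0 ≤ 1 - bump δ w := fun w => sub_nonneg.2 (bump_le_one hδ w)
  have key : ∀ n, 0 ≤ h' (Circle.exp x) - ∑ j ∈ Finset.Ico (0 : ℤ) (0 + (N ^ n : ℕ)),
        partialWeight N m₀ n (x + 2 * j * Real.pi) *
          (bump δ (Circle.exp ((x + 2 * j * Real.pi) / (N : ℝ) ^ n)) *
            h' (Circle.exp ((x + 2 * j * Real.pi) / (N : ℝ) ^ n))) ∧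
      h' (Circle.exp x) - ∑ j ∈ Finset.Ico (0 : ℤ) (0 + (N ^ n : ℕ)),
        partialWeight N m₀ n (x + 2 * j * Real.pi) *
          (bump δ (Circle.exp ((x + 2 * j * Real.pi) / (N : ℝ) ^ n)) *
            h' (Circle.exp ((x + 2 * j * Real.pi) / (N : ℝ) ^ n))) ≤
      c * (hFunction N m₀ (Circle.exp x) - ∑ j ∈ Finset.Ico (0 : ℤ) (0 + (N ^ n : ℕ)),
        partialWeight N m₀ n (x + 2 * j * Real.pi) *
          (bump δ (Circle.exp ((x + 2 * j * Real.pi) / (N : ℝ) ^ n)) *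
            hFunction N m₀ (Circle.exp ((x + 2 * j * Real.pi) / (N : ℝ) ^ n)))) := by
    intro n
    rw [← hh.sum_eq hN n x 0, ← (isRuelleFixed_hFunction hN hLip hone hR).sum_eq hN n x 0,
      ← Finset.sum_sub_distrib, ← Finset.sum_sub_distrib, Finset.mul_sum]
    constructor
    · refine Finset.sum_nonneg fun j _ => ?_
      have := mul_nonneg (partialWeight_nonneg (N := N) (m₀ := m₀) n (x + 2 * j * Real.pi))
        (mul_nonneg (hb (Circle.exp ((x + 2 * j * Real.pi) / (N : ℝ) ^ n)))
          (hle (Circle.exp ((x + 2 * j * Real.pi) / (N : ℝ) ^ n))).1)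
      linarith
    · refine Finset.sum_le_sum fun j _ => ?_
      have := mul_le_mul_of_nonneg_left (mul_le_mul_of_nonneg_left
        (hle (Circle.exp ((x + 2 * j * Real.pi) / (N : ℝ) ^ n))).2
        (hb (Circle.exp ((x + 2 * j * Real.pi) / (N : ℝ) ^ n))))
        (partialWeight_nonneg (N := N) (m₀ := m₀) n (x + 2 * j * Real.pi))
      linarith
  have h3 := ge_of_tendsto' h1 fun n => (key n).1
  have h4 := le_of_tendsto_of_tendsto' h1 h2 fun n => (key n).2
  linarith

/-- The squares |m₀|² over the N roots of a point sum to N. For a point of the cycle, the root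
inside the cycle already uses all of it. -/
theorem eq_zero_of_pow_mem_cycle (hN : 2 ≤ N) (hR : ∀ z, ruelle N m₀ m₀ (fun _ => 1) z = 1)
    {C : Set Circle} (hC : IsCycle N m₀ C) {w : Circle} (hw : w ^ N ∈ C) (hwC : w ∉ C) :
    m₀ w = 0 := by
  have hN0 : (0 : ℝ) < N := by positivity
  classical
  obtain ⟨p, z, rfl, hz, hm⟩ := hC
  obtain ⟨i, hi⟩ := hw
  have hv : z (i - 1) ^ N = w ^ N := by rw [hz, sub_add_cancel, hi]
  have hne : z (i - 1) ≠ w := fun h => hwC ⟨_, h⟩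
  have hmem : ∀ u : Circle, u ∈ (finite_roots hN (w ^ N)).toFinset ↔ u ^ N = w ^ N := by
    intro u; simp
  have h1 := hR (w ^ N)
  rw [ruelle, ← Set.Finite.coe_toFinset (finite_roots hN (w ^ N)), finsum_mem_coe_finset] at h1
  have h2 : ∑ u ∈ (finite_roots hN (w ^ N)).toFinset, ‖m₀ u‖ ^ 2 = N := by
    have h3 : ((1 / N * ∑ u ∈ (finite_roots hN (w ^ N)).toFinset, ‖m₀ u‖ ^ 2 : ℝ) : ℂ) = 1 := by
      rw [← h1]
      push_cast
      congr 1
      exact Finset.sum_congr rfl fun u _ => by rw [mul_one, Complex.conj_mul']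
    have h4 : 1 / (N : ℝ) * ∑ u ∈ (finite_roots hN (w ^ N)).toFinset, ‖m₀ u‖ ^ 2 = 1 := by
      exact_mod_cast h3
    field_simp at h4
    exact h4
  have h5 : ‖m₀ (z (i - 1))‖ ^ 2 + ‖m₀ w‖ ^ 2 ≤ N := by
    rw [← h2, ← Finset.sum_pair (f := fun u => ‖m₀ u‖ ^ 2) hne]
    refine Finset.sum_le_sum_of_subset_of_nonneg ?_ fun _ _ _ => by positivity
    intro u hu
    rw [Finset.mem_insert, Finset.mem_singleton] at hu
    rw [hmem]
    rcases hu with rfl | rfl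
    · exact hv
    · rfl
  rw [hm, Real.sq_sqrt hN0.le] at h5
  have h6 : ‖m₀ w‖ ^ 2 = 0 := le_antisymm (by linarith) (by positivity)
  simpa using h6

/-- The points e^{iy/N^k} tend to 1, which is outside the finite, hence closed, set C. At the first
exit from C, `eq_zero_of_pow_mem_cycle` supplies a zero factor. -/
theorem scalingFunction_eq_zero_of_mem_cycle (hN : 2 ≤ N)
    (hR : ∀ z, ruelle N m₀ m₀ (fun _ => 1) z = 1) {C : Set Circle} (hC : IsCycle N m₀ C)
    (hdisj : Disjoint C {1}) {y : ℝ} (hy : Circle.exp y ∈ C) : scalingFunction N m₀ y = 0 := by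
  have hN0 : (N : ℝ) ≠ 0 := by positivity
  by_cases hall : ∀ k : ℕ, Circle.exp (y / (N : ℝ) ^ k) ∈ C
  · exfalso
    have hclosed : IsClosed C := by
      obtain ⟨p, z, rfl, -⟩ := hC
      exact (Set.finite_range z).isClosed
    have hlim : Tendsto (fun k : ℕ => Circle.exp (y / (N : ℝ) ^ k)) atTop (𝓝 (Circle.exp 0)) :=
      (Circle.exp.continuous.tendsto 0).comp (tendsto_const_nhds.div_atTop
        (tendsto_pow_atTop_atTop_of_one_lt (by exact_mod_cast (by omega : 1 < N))))
    have h1 := hclosed.mem_of_tendsto hlim (Eventually.of_forall hall)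
    rw [Circle.exp_zero] at h1
    exact Set.disjoint_left.1 hdisj h1 rfl
  · push Not at hall
    classical
    obtain ⟨k, hk, hmin⟩ : ∃ k : ℕ, Circle.exp (y / (N : ℝ) ^ (k + 1)) ∉ C ∧
        Circle.exp (y / (N : ℝ) ^ k) ∈ C := by
      have hpos : Nat.find hall ≠ 0 := fun h0 => by
        have := Nat.find_spec hall
        rw [h0] at this
        simp only [pow_zero, div_one] at this
        exact this hy
      obtain ⟨k, hk⟩ := Nat.exists_eq_succ_of_ne_zero hpos
      refine ⟨k, ?_, ?_⟩
      · have := Nat.find_spec hall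
        rwa [hk] at this
      · exact not_not.1 (Nat.find_min hall (by rw [hk]; exact Nat.lt_succ_self k))
    have hpow : Circle.exp (y / (N : ℝ) ^ (k + 1)) ^ N = Circle.exp (y / (N : ℝ) ^ k) := by
      rw [← Circle.exp_natCast_mul]
      congr 1
      field_simp
      ring
    have h0 := eq_zero_of_pow_mem_cycle hN hR hC (by rwa [hpow]) hk
    exact tprod_of_exists_eq_zero ⟨k, by rw [factor, h0, zero_div]⟩

theorem hFunction_eq_zero_of_mem_cycle (hN : 2 ≤ N)
    (hR : ∀ z, ruelle N m₀ m₀ (fun _ => 1) z = 1) {C : Set Circle} (hC : IsCycle N m₀ C)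
    (hdisj : Disjoint C {1}) {z : Circle} (hz : z ∈ C) : hFunction N m₀ z = 0 := by
  rw [hFunction, periodization]
  have h : ∀ k : ℤ, ‖scalingFunction N m₀ (Complex.arg z + 2 * k * Real.pi)‖ ^ 2 = 0 := fun k => by
    rw [scalingFunction_eq_zero_of_mem_cycle hN hR hC hdisj, norm_zero, zero_pow two_ne_zero]
    rwa [exp_add_two_mul_int_mul_pi, Circle.exp_arg]
  simp [h]

end FixedPoint

/-! ### Degree reduction for trigonometric polynomials. -/

section TrigPolynomial

open Filter Topology

variable {N : ℕ} {m₀ : Circle → ℂ} {K : NNReal}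

/-- The trigonometric polynomials of degree at most `M`. -/
def trigPolynomials (M : ℕ) : Submodule ℂ (Circle → ℂ) :=
  Submodule.span ℂ ((fun (k : ℤ) (z : Circle) => (z : ℂ) ^ k) '' Set.Icc (-M : ℤ) M)

theorem zpow_mem_trigPolynomials {M : ℕ} {k : ℤ} (hk : |k| ≤ M) :
    (fun z : Circle => (z : ℂ) ^ k) ∈ trigPolynomials M :=
  Submodule.subset_span ⟨k, abs_le.1 hk, rfl⟩

theorem trigPolynomials_mono {M M' : ℕ} (h : M ≤ M') : trigPolynomials M ≤ trigPolynomials M' :=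
  Submodule.span_mono (Set.image_mono (Set.Icc_subset_Icc (by lia) (by lia)))

theorem isTrigPolynomial_of_mem {M : ℕ} {f : Circle → ℂ} (hf : f ∈ trigPolynomials M) :
    IsTrigPolynomial f := by
  obtain ⟨a, -, rfl⟩ := (Finsupp.mem_span_image_iff_linearCombination ℂ).1 hf
  refine ⟨a, fun z => ?_⟩
  simp [Finsupp.linearCombination_apply, Finsupp.sum]

theorem sum_zpow_mem_trigPolynomials (a : ℤ →₀ ℂ) :
    (fun z : Circle => a.sum fun n c => c * (z : ℂ) ^ n) ∈
      trigPolynomials (a.support.sup Int.natAbs) := by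
  have h : (fun z : Circle => a.sum fun n c => c * (z : ℂ) ^ n) =
      ∑ n ∈ a.support, a n • fun z : Circle => (z : ℂ) ^ n := by
    funext z
    simp [Finsupp.sum]
  rw [h]
  refine Submodule.sum_mem _ fun n hn => Submodule.smul_mem _ _ (zpow_mem_trigPolynomials ?_)
  rw [Int.abs_eq_natAbs]
  exact_mod_cast Finset.le_sup (f := Int.natAbs) hn

theorem IsTrigPolynomial.exists_mem {f : Circle → ℂ} (hf : IsTrigPolynomial f) :
    ∃ M, f ∈ trigPolynomials M := by
  obtain ⟨a, ha⟩ := hf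
  exact ⟨_, (funext ha : f = _) ▸ sum_zpow_mem_trigPolynomials a⟩

theorem mul_mem_trigPolynomials {M M' : ℕ} {f g : Circle → ℂ} (hf : f ∈ trigPolynomials M)
    (hg : g ∈ trigPolynomials M') : f * g ∈ trigPolynomials (M + M') := by
  have h := Submodule.mul_mem_mul hf hg
  rw [trigPolynomials, trigPolynomials, Submodule.span_mul_span] at h
  refine Submodule.span_mono ?_ h
  rintro _ ⟨_, ⟨k, hk, rfl⟩, _, ⟨l, hl, rfl⟩, rfl⟩
  rw [Set.mem_Icc] at hk hl
  refine ⟨k + l, ⟨by push_cast; linarith, by push_cast; linarith⟩, ?_⟩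
  funext z
  exact zpow_add₀ z.coe_ne_zero k l

theorem conj_mem_trigPolynomials {M : ℕ} {f : Circle → ℂ} (hf : f ∈ trigPolynomials M) :
    (fun z => (starRingEnd ℂ) (f z)) ∈ trigPolynomials M := by
  induction hf using Submodule.span_induction with
  | mem f hf =>
    obtain ⟨k, hk, rfl⟩ := hf
    have h : (fun z : Circle => (starRingEnd ℂ) ((z : ℂ) ^ k)) = fun z : Circle => (z : ℂ) ^ (-k) := by
      funext z
      rw [map_zpow₀, ← Circle.coe_inv_eq_conj, Circle.coe_inv, inv_zpow, zpow_neg]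
    simp only [h]
    exact zpow_mem_trigPolynomials (by rw [abs_neg]; exact abs_le.2 hk)
  | zero =>
    simp only [Pi.zero_apply, map_zero]
    exact (trigPolynomials M).zero_mem
  | add f g _ _ hf hg => simpa using! (trigPolynomials M).add_mem hf hg
  | smul c f _ hf => simpa using! (trigPolynomials M).smul_mem ((starRingEnd ℂ) c) hf

/-- The average of a function over the `N`-th roots. -/
noncomputable def rootAverage (N : ℕ) : (Circle → ℂ) →ₗ[ℂ] (Circle → ℂ) where
  toFun q z := (1 / (N : ℂ)) * ∑ j ∈ Finset.range N,
    q (Circle.exp ((Complex.arg z + 2 * j * Real.pi) / N))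
  map_add' p q := by
    funext z
    simp [Finset.sum_add_distrib, mul_add]
  map_smul' c q := by
    funext z
    simp only [Pi.smul_apply, smul_eq_mul, ← Finset.mul_sum, RingHom.id_apply]
    ring

theorem ruelle_eq_rootAverage (hN : 2 ≤ N) (f : Circle → ℂ) :
    ruelle N m₀ m₀ f = rootAverage N ((fun z => (starRingEnd ℂ) (m₀ z)) * m₀ * f) := by
  funext z
  conv_lhs => rw [← Circle.exp_arg z, ruelle, finsum_roots_eq hN]
  rfl

/-- The average of z^k over the N-th roots is z^(k/N) if N divides k; otherwise it is a geometric
sum over a nontrivial N-th root of unity, hence zero. -/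
theorem rootAverage_zpow_mem (hN : 2 ≤ N) {k : ℤ} {M : ℕ} (hk : |k| < N * (M + 1)) :
    rootAverage N (fun z => (z : ℂ) ^ k) ∈ trigPolynomials M := by
  have hN0 : (N : ℝ) ≠ 0 := by positivity
  have hNC : (N : ℂ) ≠ 0 := by exact_mod_cast hN0
  by_cases hdvd : (N : ℤ) ∣ k
  · obtain ⟨l, rfl⟩ := hdvd
    have h : rootAverage N (fun z => (z : ℂ) ^ ((N : ℤ) * l)) = fun z : Circle => (z : ℂ) ^ l := by
      funext z
      have hterm : ∀ j ∈ Finset.range N,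
          (Circle.exp ((Complex.arg z + 2 * j * Real.pi) / N) : ℂ) ^ ((N : ℤ) * l) =
            (z : ℂ) ^ l := by
        intro j _
        rw [zpow_mul, zpow_natCast, ← Circle.coe_pow, ← Circle.exp_natCast_mul,
          mul_div_cancel₀ _ hN0]
        have := exp_add_two_mul_int_mul_pi (Complex.arg z) j
        rw [Int.cast_natCast] at this
        rw [this, Circle.exp_arg]
      change (1 / (N : ℂ)) * ∑ j ∈ Finset.range N, _ = _
      rw [Finset.sum_congr rfl hterm, Finset.sum_const, Finset.card_range, nsmul_eq_mul]
      field_simp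
    rw [h]
    refine zpow_mem_trigPolynomials ?_
    rw [abs_mul, Nat.abs_cast] at hk
    have := lt_of_mul_lt_mul_left hk (by positivity)
    linarith
  · have h : rootAverage N (fun z => (z : ℂ) ^ k) = 0 := by
      funext z
      set ζ : ℂ := (Circle.exp (2 * Real.pi / N * k) : ℂ) with hζ
      have hterm : ∀ j ∈ Finset.range N,
          (Circle.exp ((Complex.arg z + 2 * j * Real.pi) / N) : ℂ) ^ k =
            (Circle.exp (Complex.arg z / N * k) : ℂ) * ζ ^ j := by
        intro j _
        rw [hζ, ← Circle.coe_pow, ← Circle.exp_natCast_mul, ← Circle.coe_mul, ← Circle.exp_add,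
          ← Circle.coe_zpow, ← Circle.exp_intCast_mul]
        congr 2
        ring
      have hζ1 : ζ - 1 ≠ 0 := by
        intro h0
        have h1 : Circle.exp (2 * Real.pi / N * k) = 1 := by
          ext; rw [Circle.coe_one]; exact sub_eq_zero.1 h0
        obtain ⟨m, hm⟩ := Circle.exp_eq_one.1 h1
        refine hdvd ⟨m, ?_⟩
        have hpi := Real.pi_ne_zero
        field_simp at hm
        exact_mod_cast hm
      have hζN : ζ ^ N = 1 := by
        rw [hζ, ← Circle.coe_pow, ← Circle.exp_natCast_mul,
          show (N : ℝ) * (2 * Real.pi / N * k) = 2 * Real.pi * k by field_simp,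
          Circle.exp_two_pi_mul_int, Circle.coe_one]
      have hgeom : ∑ j ∈ Finset.range N, ζ ^ j = 0 := by
        have := geom_sum_mul ζ N
        rw [hζN, sub_self] at this
        exact (mul_eq_zero.1 this).resolve_right hζ1
      change (1 / (N : ℂ)) * ∑ j ∈ Finset.range N, _ = _
      rw [Finset.sum_congr rfl hterm, ← Finset.mul_sum, hgeom, mul_zero, mul_zero]
      rfl
    rw [h]
    exact Submodule.zero_mem _

theorem rootAverage_mem (hN : 2 ≤ N) {M M' : ℕ} (hM : M' < N * (M + 1)) {q : Circle → ℂ}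
    (hq : q ∈ trigPolynomials M') : rootAverage N q ∈ trigPolynomials M := by
  have h : (trigPolynomials M').map (rootAverage N) ≤ trigPolynomials M := by
    rw [trigPolynomials, Submodule.map_span_le]
    rintro _ ⟨k, hk, rfl⟩
    refine rootAverage_zpow_mem hN ((abs_le.2 hk).trans_lt ?_)
    exact_mod_cast hM
  exact h (Submodule.mem_map_of_mem hq)

/-- Multiplication by |m₀|² adds 2D to the degree and averaging divides it by N ≥ 2, so the excess c
over 2D drops by at least one. Truncated subtraction makes degree 2D stable. -/
theorem ruelle_mem_trigPolynomials (hN : 2 ≤ N) {D c : ℕ} (hm : m₀ ∈ trigPolynomials D)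
    {f : Circle → ℂ} (hf : f ∈ trigPolynomials (2 * D + c)) :
    ruelle N m₀ m₀ f ∈ trigPolynomials (2 * D + (c - 1)) := by
  rw [ruelle_eq_rootAverage hN]
  refine rootAverage_mem hN (M' := D + D + (2 * D + c)) ?_
    (mul_mem_trigPolynomials (mul_mem_trigPolynomials (conj_mem_trigPolynomials hm) hm) hf)
  calc D + D + (2 * D + c) < 2 * (2 * D + (c - 1) + 1) := by lia
    _ ≤ N * (2 * D + (c - 1) + 1) := Nat.mul_le_mul_right _ hN

theorem iterate_ruelle_mem_trigPolynomials (hN : 2 ≤ N) {D : ℕ} (hm : m₀ ∈ trigPolynomials D)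
    (n : ℕ) : ∀ {c : ℕ} {f : Circle → ℂ}, f ∈ trigPolynomials (2 * D + c) →
      (ruelle N m₀ m₀)^[n] f ∈ trigPolynomials (2 * D + (c - n)) := by
  induction n with
  | zero => intro c f hf; simpa using hf
  | succ n ih =>
    intro c f hf
    rw [Function.iterate_succ_apply, show c - (n + 1) = c - 1 - n by lia]
    exact ih (ruelle_mem_trigPolynomials hN hm hf)

/-- Each iterate is an average with nonnegative weights of sum 1, hence a contraction for the
supremum norm. -/
theorem norm_iterate_ruelle_sub_le (hN : 2 ≤ N) (hR : ∀ z, ruelle N m₀ m₀ (fun _ => 1) z = 1)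
    {f g : Circle → ℂ} {η : ℝ} (h : ∀ z, ‖f z - g z‖ ≤ η) (n : ℕ) (z : Circle) :
    ‖(ruelle N m₀ m₀)^[n] f z - (ruelle N m₀ m₀)^[n] g z‖ ≤ η := by
  obtain ⟨x, rfl⟩ := Circle.exp_surjective z
  rw [iterate_ruelle_exp_Ico hN f n x 0, iterate_ruelle_exp_Ico hN g n x 0,
    ← Finset.sum_sub_distrib, ← one_mul η, ← sum_partialWeight_eq_one hN hR n x 0, Finset.sum_mul]
  refine norm_sum_le_of_le _ fun j _ => ?_
  rw [← smul_sub, norm_smul, Real.norm_of_nonneg (partialWeight_nonneg _ _)]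
  exact mul_le_mul_of_nonneg_left (h _) (partialWeight_nonneg _ _)

theorem exists_trigPolynomial_near {g : Circle → ℂ} (hg : Continuous g) {η : ℝ} (hη : 0 < η) :
    ∃ M, ∃ p ∈ trigPolynomials M, ∀ z, ‖p z - g z‖ ≤ η := by
  let e := AddCircle.homeomorphCircle (T := (1 : ℝ)) one_ne_zero
  let G : C(AddCircle (1 : ℝ), ℂ) := ⟨g ∘ e, hg.comp e.continuous⟩
  have h1 : G ∈ (Submodule.span ℂ (Set.range (@fourier (1 : ℝ)))).topologicalClosure := by
    rw [span_fourier_closure_eq_top]; trivial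
  obtain ⟨P, hP, hPG⟩ := Metric.mem_closure_iff.1 h1 η hη
  obtain ⟨a, rfl⟩ := Finsupp.mem_span_range_iff_exists_finsupp.1 hP
  refine ⟨_, _, sum_zpow_mem_trigPolynomials a, fun z => ?_⟩
  obtain ⟨t, rfl⟩ := e.surjective z
  have h2 := (ContinuousMap.norm_coe_le_norm ((a.sum fun i c => c • fourier i) - G) t)
  rw [← dist_eq_norm, dist_comm] at h2
  refine le_trans (le_of_eq ?_) (h2.trans hPG.le)
  rw [ContinuousMap.sub_apply]
  congr 2
  rw [Finsupp.sum, Finsupp.sum, ContinuousMap.sum_apply]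
  refine Finset.sum_congr rfl fun n _ => ?_
  rw [ContinuousMap.smul_apply, fourier_apply, AddCircle.toCircle_zsmul, Circle.coe_zpow,
    smul_eq_mul, AddCircle.homeomorphCircle_apply]

theorem isTrigPolynomial_hFunction (hN : 2 ≤ N) (hLip : LipschitzWith K m₀)
    (hone : m₀ 1 = ((√(N : ℝ) : ℝ) : ℂ)) (hR : ∀ z, ruelle N m₀ m₀ (fun _ => 1) z = 1)
    (hm : IsTrigPolynomial m₀) : IsTrigPolynomial fun z => (hFunction N m₀ z : ℂ) := by
  obtain ⟨D, hD⟩ := hm.exists_mem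
  obtain ⟨δ, hδ, hlim⟩ := exists_bump_tendsto hN hLip hone hR
  have hlim1 := hlim (fun _ => 1) continuous_const
  simp only [mul_one] at hlim1
  have hg : Continuous fun w => (bump δ w : ℂ) :=
    Complex.continuous_ofReal.comp (continuous_bump δ)
  have happrox : ∀ k : ℕ, ∃ c, ∃ p ∈ trigPolynomials (2 * D + c),
      ∀ z, ‖p z - (bump δ z : ℂ)‖ ≤ 1 / ((k : ℝ) + 1) := by
    intro k
    obtain ⟨M, p, hp, hpg⟩ := exists_trigPolynomial_near hg (Nat.one_div_pos_of_nat (n := k))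
    exact ⟨M, p, trigPolynomials_mono (by lia) hp, hpg⟩
  choose c p hp hpg using happrox
  -- A finite-dimensional subspace is closed for pointwise convergence, so pointwise limits of
  -- polynomials of degree at most 2D stay in it.
  have : FiniteDimensional ℂ (trigPolynomials (2 * D)) :=
    FiniteDimensional.span_of_finite ℂ ((Set.finite_Icc _ _).image _)
  refine isTrigPolynomial_of_mem ((trigPolynomials (2 * D)).closed_of_finiteDimensional.mem_of_tendsto
    -- At least c k iterations bring the degree of p k down to 2D; at least k of them make the
    -- iterates of the bump converge to h.
    (f := fun k => (ruelle N m₀ m₀)^[max k (c k)] (p k)) (b := atTop) ?_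
    (Eventually.of_forall fun k => ?_))
  · rw [tendsto_pi_nhds]
    intro z
    have h1 : Tendsto (fun k => (ruelle N m₀ m₀)^[max k (c k)] (fun w => (bump δ w : ℂ)) z) atTop
        (𝓝 (hFunction N m₀ z : ℂ)) :=
      (hlim1 z).comp (tendsto_atTop_mono (fun k => le_max_left k (c k)) tendsto_id)
    have h2 : Tendsto (fun k => (ruelle N m₀ m₀)^[max k (c k)] (p k) z -
        (ruelle N m₀ m₀)^[max k (c k)] (fun w => (bump δ w : ℂ)) z) atTop (𝓝 0) :=
      squeeze_zero_norm (fun k => norm_iterate_ruelle_sub_le hN hR (hpg k) _ z)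
        tendsto_one_div_add_atTop_nhds_zero_nat
    simpa using h2.add h1
  · have h := iterate_ruelle_mem_trigPolynomials hN hD (max k (c k)) (hp k)
    rwa [Nat.sub_eq_zero_of_le (le_max_right _ _), add_zero] at h

end TrigPolynomial

/-! ### Push-forward of |φ|² to the circle. -/

section Periodization

variable {N : ℕ} {m₀ : Circle → ℂ} {K : NNReal}

/-- The line is tiled by the 2πk-translates of (-π, π]. -/
theorem lintegral_eq_lintegral_tsum_translates {g : ℝ → ℝ≥0∞} (hg : Measurable g) :
    ∫⁻ x, g x = ∫⁻ x in Set.Ioc (-Real.pi) Real.pi, ∑' k : ℤ, g (x + 2 * k * Real.pi) := by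
  have hp : (0 : ℝ) < 2 * Real.pi := by positivity
  have hk : ∀ k : ℤ, Measurable fun x => g (x + 2 * k * Real.pi) := fun k =>
    hg.comp (measurable_add_const _)
  rw [lintegral_tsum fun k => (hk k).aemeasurable, ← setLIntegral_univ, ← iUnion_Ioc_add_zsmul hp (-Real.pi),
    lintegral_iUnion (fun _ => measurableSet_Ioc) (Set.pairwise_disjoint_Ioc_add_zsmul _ _)]
  refine tsum_congr fun k => ?_
  have h := (measurePreserving_add_right (volume : Measure ℝ) (2 * k * Real.pi)).setLIntegral_comp_preimage
    (s := Set.Ioc (-Real.pi + k • (2 * Real.pi)) (-Real.pi + (k + 1) • (2 * Real.pi)))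
    measurableSet_Ioc hg
  rw [← h, Set.preimage_add_const_Ioc]
  simp only [zsmul_eq_mul, Int.cast_add, Int.cast_one]
  congr 3 <;> ring

/-- The push-forward of `|φ_{m₀,1}|² dx / 2π` to the circle has density `h_{m₀,1}`. -/
theorem map_exp_withDensity_scalingFunction (hN : 2 ≤ N) (hLip : LipschitzWith K m₀)
    (hone : m₀ 1 = ((√(N : ℝ) : ℝ) : ℂ)) (hR : ∀ z, ruelle N m₀ m₀ (fun _ => 1) z = 1) :
    Measure.map Circle.exp
      (lineMeasure.withDensity fun x => ENNReal.ofReal (‖scalingFunction N m₀ x‖ ^ 2)) =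
    circleHaar.withDensity fun z => ENNReal.ofReal (hFunction N m₀ z) := by
  obtain ⟨L, hL⟩ := exists_lipschitzWith_hFunction hN hLip hone hR
  have hexp : Measurable Circle.exp := Circle.exp.continuous.measurable
  have hφ : Measurable fun x => ENNReal.ofReal (‖scalingFunction N m₀ x‖ ^ 2) :=
    ((continuous_scalingFunction hN hLip hone).norm.pow 2).measurable.ennreal_ofReal
  have hh : Measurable fun z => ENNReal.ofReal (hFunction N m₀ z) :=
    hL.continuous.measurable.ennreal_ofReal
  ext s hs
  rw [Measure.map_apply hexp hs, withDensity_apply _ (hexp hs), withDensity_apply _ hs,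
    ← lintegral_indicator (hexp hs), ← lintegral_indicator hs,
    ← measurePreserving_exp.lintegral_comp (hh.indicator hs), lineMeasure,
    lintegral_smul_measure, lintegral_smul_measure,
    lintegral_eq_lintegral_tsum_translates (hφ.indicator (hexp hs))]
  congr 1
  refine lintegral_congr fun x => ?_
  by_cases hx : Circle.exp x ∈ s
  · have h1 : ∀ k : ℤ, x + 2 * k * Real.pi ∈ Circle.exp ⁻¹' s := fun k => by
      rwa [Set.mem_preimage, exp_add_two_mul_int_mul_pi]
    simp only [Set.indicator_of_mem (h1 _), Set.indicator_of_mem hx]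
    have h2 := hasSum_hFunction hN hLip hone hR x
    rw [← h2.tsum_eq, ENNReal.ofReal_tsum_of_nonneg (fun _ => by positivity) h2.summable]
  · have h1 : ∀ k : ℤ, x + 2 * k * Real.pi ∉ Circle.exp ⁻¹' s := fun k => by
      rwa [Set.mem_preimage, exp_add_two_mul_int_mul_pi]
    simp only [Set.indicator_of_notMem (h1 _), Set.indicator_of_notMem hx, tsum_zero]

/-- The total mass of |φ|² equals the integral of h over the circle, and h ≤ 1. -/
theorem memLp_scalingFunction_lineMeasure (hN : 2 ≤ N) (hLip : LipschitzWith K m₀)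
    (hone : m₀ 1 = ((√(N : ℝ) : ℝ) : ℂ)) (hR : ∀ z, ruelle N m₀ m₀ (fun _ => 1) z = 1) :
    MemLp (scalingFunction N m₀) 2 lineMeasure := by
  have hc := continuous_scalingFunction hN hLip hone
  rw [memLp_two_iff_integrable_sq_norm hc.aestronglyMeasurable]
  refine ⟨(hc.norm.pow 2).aestronglyMeasurable, ?_⟩
  rw [hasFiniteIntegral_iff_ofReal (Filter.Eventually.of_forall fun _ => by positivity)]
  have h := congrArg (fun μ : Measure Circle => μ Set.univ)
    (map_exp_withDensity_scalingFunction hN hLip hone hR)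
  simp only [Measure.map_apply Circle.exp.continuous.measurable MeasurableSet.univ,
    Set.preimage_univ, withDensity_apply _ MeasurableSet.univ, setLIntegral_univ] at h
  rw [h]
  have h1 : ∀ z, ENNReal.ofReal (hFunction N m₀ z) ≤ 1 := fun z => by
    rw [ENNReal.ofReal_le_one]
    exact hFunction_le_of_isRuelleFixed hN hLip hone hR continuous_const
      (fun _ => zero_le_one) (isRuelleFixed_one hR) rfl z
  calc ∫⁻ z, ENNReal.ofReal (hFunction N m₀ z) ∂circleHaar ≤ ∫⁻ _, 1 ∂circleHaar :=
        lintegral_mono h1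
    _ = 1 := by simp
    _ < ⊤ := ENNReal.one_lt_top

theorem volume_eq_smul_lineMeasure :
    (volume : Measure ℝ) = ENNReal.ofReal (2 * Real.pi) • lineMeasure := by
  rw [lineMeasure, smul_smul, ← ENNReal.ofReal_mul (by positivity),
    mul_inv_cancel₀ (by positivity), ENNReal.ofReal_one, one_smul]

theorem memLp_scalingFunction (hN : 2 ≤ N) (hLip : LipschitzWith K m₀)
    (hone : m₀ 1 = ((√(N : ℝ) : ℝ) : ℂ)) (hR : ∀ z, ruelle N m₀ m₀ (fun _ => 1) z = 1) :
    MemLp (scalingFunction N m₀) 2 volume := by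
  rw [volume_eq_smul_lineMeasure]
  exact (memLp_scalingFunction_lineMeasure hN hLip hone hR).smul_measure ENNReal.ofReal_ne_top

theorem ae_lineMeasure_iff {p : ℝ → Prop} :
    (∀ᵐ x ∂lineMeasure, p x) ↔ ∀ᵐ x ∂(volume : Measure ℝ), p x := by
  refine ⟨fun h => ?_, fun h => Measure.ae_smul_measure h _⟩
  rw [volume_eq_smul_lineMeasure]
  exact Measure.ae_smul_measure h _

theorem integral_comp_exp_mul_scalingFunction (hN : 2 ≤ N) (hLip : LipschitzWith K m₀)
    (hone : m₀ 1 = ((√(N : ℝ) : ℝ) : ℂ)) (hR : ∀ z, ruelle N m₀ m₀ (fun _ => 1) z = 1)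
    {f : Circle → ℂ} (hf : AEStronglyMeasurable f circleHaar) :
    ∫ x, f (Circle.exp x) * ((‖scalingFunction N m₀ x‖ ^ 2 : ℝ) : ℂ) ∂lineMeasure =
      ∫ z, f z * (hFunction N m₀ z : ℂ) ∂circleHaar := by
  obtain ⟨L, hL⟩ := exists_lipschitzWith_hFunction hN hLip hone hR
  have hφ : Measurable fun x => ENNReal.ofReal (‖scalingFunction N m₀ x‖ ^ 2) :=
    ((continuous_scalingFunction hN hLip hone).norm.pow 2).measurable.ennreal_ofReal
  have hh : Measurable fun z => ENNReal.ofReal (hFunction N m₀ z) :=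
    hL.continuous.measurable.ennreal_ofReal
  have hmap := map_exp_withDensity_scalingFunction hN hLip hone hR
  have h1 : ∫ z, f z ∂(circleHaar.withDensity fun z => ENNReal.ofReal (hFunction N m₀ z)) =
      ∫ x, f (Circle.exp x)
        ∂(lineMeasure.withDensity fun x => ENNReal.ofReal (‖scalingFunction N m₀ x‖ ^ 2)) := by
    rw [← hmap, integral_map Circle.exp.continuous.measurable.aemeasurable]
    rw [hmap]
    exact hf.mono_ac (withDensity_absolutelyContinuous _ _)
  rw [integral_withDensity_eq_integral_toReal_smul hφ
      (Filter.Eventually.of_forall fun _ => ENNReal.ofReal_lt_top),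
    integral_withDensity_eq_integral_toReal_smul hh
      (Filter.Eventually.of_forall fun _ => ENNReal.ofReal_lt_top)] at h1
  simp only [ENNReal.toReal_ofReal (hFunction_nonneg _), Complex.real_smul,
    ENNReal.toReal_ofReal (sq_nonneg ‖scalingFunction N m₀ _‖)] at h1
  simp only [mul_comm (f _), ← h1]

end Periodization

/-! ### Uniqueness of Fourier transforms of integrable densities. -/

section FourierUniqueness

/-- The positive and negative parts of g are densities of finite measures with the same
characteristic function, hence agree almost everywhere; at each point one of them is zero. -/
theorem ae_eq_zero_of_integral_exp_mul_ofReal_eq_zero {μ : Measure ℝ} {g : ℝ → ℝ}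
    (hg : Integrable g μ) (h : ∀ t : ℝ, ∫ x, Complex.exp (t * x * Complex.I) * (g x : ℂ) ∂μ = 0) :
    g =ᵐ[μ] 0 := by
  have hp : AEMeasurable (fun x => ENNReal.ofReal (g x)) μ := hg.aestronglyMeasurable.aemeasurable.ennreal_ofReal
  have hn : AEMeasurable (fun x => ENNReal.ofReal (-g x)) μ := hg.aestronglyMeasurable.aemeasurable.neg.ennreal_ofReal
  have hpf : ∫⁻ x, ENNReal.ofReal (g x) ∂μ ≠ ∞ := hg.lintegral_lt_top.ne
  have hnf : ∫⁻ x, ENNReal.ofReal (-g x) ∂μ ≠ ∞ := hg.neg.lintegral_lt_top.ne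
  have : IsFiniteMeasure (μ.withDensity fun x => ENNReal.ofReal (g x)) :=
    isFiniteMeasure_withDensity hpf
  have : IsFiniteMeasure (μ.withDensity fun x => ENNReal.ofReal (-g x)) :=
    isFiniteMeasure_withDensity hnf
  have hexp : ∀ t : ℝ, ∀ x : ℝ, ‖Complex.exp (t * x * Complex.I)‖ ≤ 1 := fun t x => by
    rw [← Complex.ofReal_mul, Complex.norm_exp_ofReal_mul_I]
  have hint : ∀ t : ℝ, ∀ k : ℝ → ℝ, Integrable k μ →
      Integrable (fun x => (k x) • Complex.exp (t * x * Complex.I)) μ := fun t k hk =>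
    hk.smul_bdd 1 (by fun_prop) (Filter.Eventually.of_forall (hexp t))
  have heq : (μ.withDensity fun x => ENNReal.ofReal (g x)) =
      μ.withDensity fun x => ENNReal.ofReal (-g x) := by
    refine Measure.ext_of_charFun (funext fun t => ?_)
    rw [charFun_apply_real, charFun_apply_real,
      integral_withDensity_eq_integral_toReal_smul₀ hp
        (Filter.Eventually.of_forall fun _ => ENNReal.ofReal_lt_top),
      integral_withDensity_eq_integral_toReal_smul₀ hn
        (Filter.Eventually.of_forall fun _ => ENNReal.ofReal_lt_top), ← sub_eq_zero,
      ← integral_sub (hint t _ (by simpa only [ENNReal.toReal_ofReal'] using hg.pos_part))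
        (hint t _ (by simpa only [ENNReal.toReal_ofReal'] using hg.neg_part)), ← h t]
    refine integral_congr_ae (Filter.Eventually.of_forall fun x => ?_)
    simp only [ENNReal.toReal_ofReal', Complex.real_smul]
    rw [← sub_mul, ← Complex.ofReal_sub, max_zero_sub_eq_self, mul_comm]
  filter_upwards [(withDensity_eq_iff hp hn hpf).1 heq] with x hx
  rcases le_total 0 (g x) with h0 | h0
  · rw [ENNReal.ofReal_of_nonpos (neg_nonpos.2 h0), ENNReal.ofReal_eq_zero] at hx
    exact le_antisymm hx h0
  · rw [ENNReal.ofReal_of_nonpos h0, eq_comm, ENNReal.ofReal_eq_zero] at hx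
    exact le_antisymm h0 (neg_nonpos.1 hx)

/-- The transform is continuous in t, so vanishing on D extends to all t. Conjugation with t ↦ -t
gives the same for the conjugate of G, which separates real and imaginary parts. -/
theorem ae_eq_zero_of_integral_exp_mul_eq_zero {μ : Measure ℝ} {G : ℝ → ℂ} (hG : Integrable G μ)
    {D : Set ℝ} (hD : Dense D)
    (h : ∀ t ∈ D, ∫ x, Complex.exp (t * x * Complex.I) * G x ∂μ = 0) : G =ᵐ[μ] 0 := by
  have hexp : ∀ t : ℝ, ∀ x : ℝ, ‖Complex.exp (t * x * Complex.I)‖ = 1 := fun t x => by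
    rw [← Complex.ofReal_mul, Complex.norm_exp_ofReal_mul_I]
  have hint : ∀ t : ℝ, ∀ F : ℝ → ℂ, Integrable F μ →
      Integrable (fun x : ℝ => Complex.exp (t * x * Complex.I) * F x) μ := fun t F hF =>
    hF.bdd_mul (c := 1) (by fun_prop) (Filter.Eventually.of_forall fun x => (hexp t x).le)
  have hcont : Continuous fun t : ℝ => ∫ x, Complex.exp (t * x * Complex.I) * G x ∂μ :=
    continuous_of_dominated (bound := fun x => ‖G x‖) (fun t => (hint t G hG).aestronglyMeasurable)
      (fun t => Filter.Eventually.of_forall fun x => by rw [norm_mul, hexp, one_mul]) hG.norm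
      (Filter.Eventually.of_forall fun x => by fun_prop)
  have hall : ∀ t : ℝ, ∫ x, Complex.exp (t * x * Complex.I) * G x ∂μ = 0 := fun t => by
    have h1 : closure D ⊆ {t : ℝ | ∫ x, Complex.exp (t * x * Complex.I) * G x ∂μ = 0} :=
      closure_minimal h (isClosed_eq hcont continuous_const)
    exact h1 (hD.closure_eq ▸ Set.mem_univ t)
  have hconj : ∀ t : ℝ, ∫ x, Complex.exp (t * x * Complex.I) * (starRingEnd ℂ) (G x) ∂μ = 0 := by
    intro t
    have h1 := congrArg (starRingEnd ℂ) (hall (-t))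
    rw [← integral_conj, map_zero] at h1
    rw [← h1]
    refine integral_congr_ae (Filter.Eventually.of_forall fun x => ?_)
    simp only [map_mul, ← Complex.exp_conj, Complex.conj_I, Complex.conj_ofReal]
    congr 2
    push_cast
    ring
  have hGc : Integrable (fun x => (starRingEnd ℂ) (G x)) μ :=
    Complex.conjLIE.toContinuousLinearEquiv.toContinuousLinearMap.integrable_comp hG
  have hre : (fun x => (G x).re) =ᵐ[μ] 0 := by
    refine ae_eq_zero_of_integral_exp_mul_ofReal_eq_zero hG.re fun t => ?_
    have h1 : ∀ x : ℝ, Complex.exp (t * x * Complex.I) * ((G x).re : ℂ) = (1 / 2 : ℂ) *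
        (Complex.exp (t * x * Complex.I) * G x +
          Complex.exp (t * x * Complex.I) * (starRingEnd ℂ) (G x)) := fun x => by
      rw [← mul_add, Complex.add_conj]; push_cast; ring
    simp_rw [h1]
    rw [integral_const_mul, integral_add (hint t G hG) (hint t _ hGc), hall, hconj]
    simp
  have him : (fun x => (G x).im) =ᵐ[μ] 0 := by
    refine ae_eq_zero_of_integral_exp_mul_ofReal_eq_zero hG.im fun t => ?_
    have h1 : ∀ x : ℝ, Complex.exp (t * x * Complex.I) * ((G x).im : ℂ) = (-Complex.I / 2 : ℂ) *
        (Complex.exp (t * x * Complex.I) * G x -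
          Complex.exp (t * x * Complex.I) * (starRingEnd ℂ) (G x)) := fun x => by
      rw [← mul_sub, Complex.sub_conj]
      push_cast
      linear_combination (Complex.exp (t * x * Complex.I) * ((G x).im : ℂ)) * Complex.I_sq
    simp_rw [h1]
    rw [integral_const_mul, integral_sub (hint t G hG) (hint t _ hGc), hall, hconj]
    simp
  filter_upwards [hre, him] with x h1 h2
  exact Complex.ext h1 h2

end FourierUniqueness

/-! ### Dilation, multiplication operators and characters on L²(ℝ). -/

section Operators

variable {N : ℕ}

theorem inner_L2Line (ξ η : L2Line) :
    inner ℂ ξ η = ∫ x, (starRingEnd ℂ) (ξ x) * η x ∂lineMeasure := by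
  rw [L2.inner_def]
  simp only [RCLike.inner_apply']

theorem coeFn_uOne (hN : 2 ≤ N) (ξ : L2Line) :
    uOne hN ξ =ᵐ[lineMeasure] fun x => ((√(N : ℝ) : ℝ) : ℂ) * ξ (N * x) := by
  have h : uOne hN ξ = ((√(N : ℝ) : ℝ) : ℂ) • dilate hN ξ := rfl
  rw [h]
  filter_upwards [Lp.coeFn_smul ((√(N : ℝ) : ℝ) : ℂ) (dilate hN ξ), coeFn_dilate hN ξ] with x h1 h2
  rw [h1, Pi.smul_apply, h2, smul_eq_mul]

theorem integral_lineMeasure_comp_mul (hN : 2 ≤ N) (g : ℝ → ℂ) :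
    (N : ℂ) * ∫ x, g (N * x) ∂lineMeasure = ∫ x, g x ∂lineMeasure := by
  have hN0 : (N : ℂ) ≠ 0 := by
    have : N ≠ 0 := by omega
    exact_mod_cast this
  rw [lineMeasure, integral_smul_measure, integral_smul_measure, Measure.integral_comp_mul_left,
    abs_of_nonneg (by positivity), mul_smul_comm]
  congr 1
  rw [Complex.real_smul]
  push_cast
  rw [mul_inv_cancel_left₀ hN0]

theorem inner_uOne (hN : 2 ≤ N) (ξ η : L2Line) :
    inner ℂ (uOne hN ξ) (uOne hN η) = inner ℂ ξ η := by
  rw [inner_L2Line, inner_L2Line,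
    ← integral_lineMeasure_comp_mul hN (fun x => (starRingEnd ℂ) (ξ x) * η x), ← integral_const_mul]
  refine integral_congr_ae ?_
  filter_upwards [coeFn_uOne hN ξ, coeFn_uOne hN η] with x h1 h2
  have h3 : ((√(N : ℝ) : ℝ) : ℂ) * ((√(N : ℝ) : ℝ) : ℂ) = N := by
    rw [← Complex.ofReal_mul, Real.mul_self_sqrt (by positivity)]; simp
  rw [h1, h2, map_mul, Complex.conj_ofReal, ← h3]
  ring

theorem surjective_uOne (hN : 2 ≤ N) : Function.Surjective (uOne hN) := by
  intro η
  have hN0 : (N : ℝ) ≠ 0 := by positivity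
  have hs0 : ((√(N : ℝ) : ℝ) : ℂ) ≠ 0 := by
    rw [Complex.ofReal_ne_zero]; positivity
  have hmap : Measure.map (fun x : ℝ => (N : ℝ)⁻¹ * x) lineMeasure =
      ENNReal.ofReal |((N : ℝ)⁻¹)⁻¹| • lineMeasure := by
    rw [lineMeasure, Measure.map_smul, Real.map_volume_mul_left (inv_ne_zero hN0), smul_comm]
  have hη : MemLp (fun x => η ((N : ℝ)⁻¹ * x)) 2 lineMeasure := by
    have h1 : MemLp η 2 (Measure.map (fun x : ℝ => (N : ℝ)⁻¹ * x) lineMeasure) := by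
      rw [hmap]
      exact (Lp.memLp η).smul_measure ENNReal.ofReal_ne_top
    exact (memLp_map_measure_iff h1.1 (measurable_const_mul _).aemeasurable).1 h1
  -- The preimage of η is N^{-1/2} η(x/N).
  refine ⟨(hη.const_mul (((√(N : ℝ) : ℝ) : ℂ)⁻¹)).toLp _, Lp.ext ?_⟩
  filter_upwards [coeFn_uOne hN ((hη.const_mul (((√(N : ℝ) : ℝ) : ℂ)⁻¹)).toLp _),
    (quasiMeasurePreserving_mul hN).ae
      (hη.const_mul (((√(N : ℝ) : ℝ) : ℂ)⁻¹)).coeFn_toLp] with x h1 h2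
  rw [h1, h2, mul_inv_cancel_left₀ hs0, inv_mul_cancel_left₀ hN0]

theorem uOne_mem_unitary (hN : 2 ≤ N) : uOne hN ∈ unitary (L2Line →L[ℂ] L2Line) := by
  have h1 : star (uOne hN) * uOne hN = 1 := by
    refine ContinuousLinearMap.ext fun ξ => ext_inner_left ℂ fun η => ?_
    change inner ℂ η (ContinuousLinearMap.adjoint (uOne hN) (uOne hN ξ)) = inner ℂ η ξ
    rw [ContinuousLinearMap.adjoint_inner_right, inner_uOne]
  refine Unitary.mem_iff.2 ⟨h1, ContinuousLinearMap.ext fun η => ?_⟩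
  obtain ⟨ξ, rfl⟩ := surjective_uOne hN η
  have h2 := congrArg (fun T : L2Line →L[ℂ] L2Line => uOne hN (T ξ)) h1
  exact h2

theorem mulOp_eq_of_ae {g : LInftyLine} {S : L2Line →L[ℂ] L2Line}
    (h : ∀ ξ, S ξ =ᵐ[lineMeasure] fun x => g x * ξ x) : S = mulOp g :=
  ContinuousLinearMap.ext fun ξ => Lp.ext ((h ξ).trans (coeFn_mulOp g ξ).symm)

theorem mulOp_mul_mulOp {f g k : LInftyLine} (h : ∀ᵐ x ∂lineMeasure, k x = f x * g x) :
    mulOp f * mulOp g = mulOp k := by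
  refine mulOp_eq_of_ae fun ξ => ?_
  filter_upwards [coeFn_mulOp f (mulOp g ξ), coeFn_mulOp g ξ, h] with x h1 h2 h3
  change mulOp f (mulOp g ξ) x = _
  rw [h1, h2, h3, mul_assoc]

theorem commute_mulOp (f g : LInftyLine) : mulOp f * mulOp g = mulOp g * mulOp f := by
  refine ContinuousLinearMap.ext fun ξ => Lp.ext ?_
  filter_upwards [coeFn_mulOp f (mulOp g ξ), coeFn_mulOp g ξ, coeFn_mulOp g (mulOp f ξ),
    coeFn_mulOp f ξ] with x h1 h2 h3 h4
  change mulOp f (mulOp g ξ) x = mulOp g (mulOp f ξ) x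
  rw [h1, h2, h3, h4]
  ring

theorem mulOp_eq_one {g : LInftyLine} (h : ∀ᵐ x ∂lineMeasure, g x = 1) : mulOp g = 1 := by
  symm
  refine mulOp_eq_of_ae fun ξ => ?_
  filter_upwards [h] with x hx
  rw [hx, one_mul, one_apply_eq_self]

theorem star_mulOp {f g : LInftyLine} (h : ∀ᵐ x ∂lineMeasure, g x = (starRingEnd ℂ) (f x)) :
    star (mulOp f) = mulOp g := by
  symm
  refine ContinuousLinearMap.ext fun ξ => ext_inner_left ℂ fun η => ?_
  change _ = inner ℂ η (ContinuousLinearMap.adjoint (mulOp f) ξ)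
  rw [ContinuousLinearMap.adjoint_inner_right, inner_L2Line, inner_L2Line]
  refine integral_congr_ae ?_
  filter_upwards [coeFn_mulOp g ξ, coeFn_mulOp f η, h] with x h1 h2 h3
  rw [h1, h2, h3, map_mul]
  ring

theorem uOne_mul_mulOp (hN : 2 ≤ N) {f g : LInftyLine}
    (h : ∀ᵐ x ∂lineMeasure, g x = f (N * x)) : uOne hN * mulOp f = mulOp g * uOne hN := by
  refine ContinuousLinearMap.ext fun ξ => Lp.ext ?_
  filter_upwards [coeFn_uOne hN (mulOp f ξ), (quasiMeasurePreserving_mul hN).ae (coeFn_mulOp f ξ),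
    coeFn_mulOp g (uOne hN ξ), coeFn_uOne hN ξ, h] with x h1 h2 h3 h4 h5
  change uOne hN (mulOp f ξ) x = mulOp g (uOne hN ξ) x
  rw [h1, h2, h3, h4, h5]
  ring

theorem memLp_exp_mul_I (t : ℝ) :
    MemLp (fun x : ℝ => Complex.exp (t * x * Complex.I)) ∞ lineMeasure :=
  memLp_top_of_bound (by fun_prop) 1 (Filter.Eventually.of_forall fun x => by
    rw [← Complex.ofReal_mul, Complex.norm_exp_ofReal_mul_I])

/-- The character `x ↦ e^{itx}` in `L^∞(ℝ)`. -/
noncomputable def lineChar (t : ℝ) : LInftyLine := (memLp_exp_mul_I t).toLp _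

theorem coeFn_lineChar (t : ℝ) :
    lineChar t =ᵐ[lineMeasure] fun x => Complex.exp (t * x * Complex.I) :=
  (memLp_exp_mul_I t).coeFn_toLp

theorem mulOp_lineChar_zero : mulOp (lineChar 0) = 1 :=
  mulOp_eq_one (by filter_upwards [coeFn_lineChar 0] with x hx; rw [hx]; simp)

theorem mulOp_lineChar_add (s t : ℝ) :
    mulOp (lineChar (s + t)) = mulOp (lineChar s) * mulOp (lineChar t) := by
  refine (mulOp_mul_mulOp ?_).symm
  filter_upwards [coeFn_lineChar s, coeFn_lineChar t, coeFn_lineChar (s + t)] with x h1 h2 h3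
  rw [h1, h2, h3, ← Complex.exp_add]
  push_cast
  ring_nf

theorem star_mulOp_lineChar (t : ℝ) : star (mulOp (lineChar t)) = mulOp (lineChar (-t)) := by
  refine star_mulOp ?_
  filter_upwards [coeFn_lineChar t, coeFn_lineChar (-t)] with x h1 h2
  rw [h1, h2, ← Complex.exp_conj]
  simp

theorem uOne_mul_mulOp_lineChar (hN : 2 ≤ N) (t : ℝ) :
    uOne hN * mulOp (lineChar t) = mulOp (lineChar (N * t)) * uOne hN := by
  refine uOne_mul_mulOp hN ?_
  filter_upwards [coeFn_lineChar (N * t),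
    (quasiMeasurePreserving_mul hN).ae (coeFn_lineChar t)] with x h1 h2
  rw [h1, h2]
  push_cast
  ring_nf

theorem piOne_coordinate : piOne coordinate = mulOp (lineChar 1) := by
  refine mulOp_eq_of_ae fun ξ => ?_
  have h : coordinate =ᵐ[circleHaar] fun z => (z : ℂ) :=
    ContinuousMap.coeFn_toLp (p := ∞) (𝕜 := ℂ) circleHaar _
  filter_upwards [coeFn_mulOp (periodicExtension coordinate) ξ, coeFn_periodicExtension coordinate,
    quasiMeasurePreserving_exp.ae h, coeFn_lineChar 1] with x h1 h2 h3 h4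
  rw [piOne, h1, h2, h3, h4, Circle.coe_exp]
  simp

/-- A monoid of operators which contains `U₁^{±1}` and multiplication by `e^{±ix}` contains
multiplication by `e^{itx}` for a dense set of frequencies `t`. -/
theorem dense_setOf_mulOp_lineChar_mem (hN : 2 ≤ N) (B : Submonoid (L2Line →L[ℂ] L2Line))
    (hU : uOne hN ∈ B) (hU' : star (uOne hN) ∈ B) (hpos : mulOp (lineChar 1) ∈ B)
    (hneg : mulOp (lineChar (-1)) ∈ B) : Dense {t : ℝ | mulOp (lineChar t) ∈ B} := by
  have hN0 : (N : ℝ) ≠ 0 := by positivity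
  have hdiv : ∀ t, mulOp (lineChar t) ∈ B → mulOp (lineChar (t / N)) ∈ B := by
    intro t ht
    -- Covariance read backwards: conjugation by the adjoint of U₁ divides the frequency by N.
    have h1 : mulOp (lineChar (t / N)) = star (uOne hN) * (mulOp (lineChar t) * uOne hN) := by
      have h2 := uOne_mul_mulOp_lineChar hN (t / N)
      rw [mul_div_cancel₀ _ hN0] at h2
      rw [← h2, ← mul_assoc, Unitary.star_mul_self_of_mem (uOne_mem_unitary hN), one_mul]
    rw [h1]
    exact B.mul_mem hU' (B.mul_mem ht hU)
  -- B need not be closed under inverses, so both signs are required in order to have a group. It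
  -- contains every 1/N^n, hence arbitrarily small positive elements, and is therefore dense.
  let D : AddSubgroup ℝ :=
    { carrier := {t | mulOp (lineChar t) ∈ B ∧ mulOp (lineChar (-t)) ∈ B}
      add_mem' := by
        rintro s t ⟨h1, h2⟩ ⟨h3, h4⟩
        refine ⟨?_, ?_⟩
        · rw [mulOp_lineChar_add]; exact B.mul_mem h1 h3
        · rw [neg_add, mulOp_lineChar_add]; exact B.mul_mem h2 h4
      zero_mem' := by
        refine ⟨?_, ?_⟩
        · rw [mulOp_lineChar_zero]; exact B.one_mem
        · rw [neg_zero, mulOp_lineChar_zero]; exact B.one_mem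
      neg_mem' := by
        rintro t ⟨h1, h2⟩
        exact ⟨h2, by rwa [neg_neg]⟩ }
  have hmem : ∀ n : ℕ, 1 / (N : ℝ) ^ n ∈ D := by
    intro n
    induction n with
    | zero => simpa using! ⟨hpos, hneg⟩
    | succ n ih =>
      have h1 := hdiv _ ih.1
      have h2 := hdiv _ ih.2
      rw [neg_div] at h2
      rw [pow_succ, ← div_div]
      exact ⟨h1, h2⟩
  have hD : Dense (D : Set ℝ) := by
    refine AddSubgroup.dense_of_not_isolated_zero D fun ε hε => ?_
    have hlim : Filter.Tendsto (fun n : ℕ => 1 / (N : ℝ) ^ n) Filter.atTop (nhds 0) :=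
      tendsto_const_nhds.div_atTop
        (tendsto_pow_atTop_atTop_of_one_lt (by exact_mod_cast (by omega : 1 < N)))
    obtain ⟨n, hn⟩ := (hlim.eventually_lt_const hε).exists
    exact ⟨_, hmem n, by positivity, hn⟩
  exact hD.mono fun t ht => ht.1

theorem inner_mulOp_lineChar (ξ η : L2Line) (t : ℝ) :
    inner ℂ ξ (mulOp (lineChar t) η) =
      ∫ x, Complex.exp (t * x * Complex.I) * ((starRingEnd ℂ) (ξ x) * η x) ∂lineMeasure := by
  rw [inner_L2Line]
  refine integral_congr_ae ?_
  filter_upwards [coeFn_mulOp (lineChar t) η, coeFn_lineChar t] with x h1 h2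
  rw [h1, h2]
  ring

theorem integrable_conj_mul (ξ η : L2Line) :
    Integrable (fun x => (starRingEnd ℂ) (ξ x) * η x) lineMeasure := by
  have h := L2.integrable_inner (𝕜 := ℂ) ξ η
  simpa only [RCLike.inner_apply'] using h

/-- Commutation says that the two sides, as integrable functions, have equal Fourier transforms on
D. This turns an operator identity into a pointwise one. -/
theorem conj_mul_ae_eq_of_commute {S : L2Line →L[ℂ] L2Line} {D : Set ℝ} (hD : Dense D)
    (hS : ∀ t ∈ D, mulOp (lineChar t) * S = S * mulOp (lineChar t)) (ξ η : L2Line) :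
    ∀ᵐ x ∂lineMeasure, (starRingEnd ℂ) (η x) * S ξ x =
      (starRingEnd ℂ) (ContinuousLinearMap.adjoint S η x) * ξ x := by
  have h1 := integrable_conj_mul η (S ξ)
  have h2 := integrable_conj_mul (ContinuousLinearMap.adjoint S η) ξ
  have h : (fun x => (starRingEnd ℂ) (η x) * S ξ x -
      (starRingEnd ℂ) (ContinuousLinearMap.adjoint S η x) * ξ x) =ᵐ[lineMeasure] 0 := by
    refine ae_eq_zero_of_integral_exp_mul_eq_zero (h1.sub h2) hD fun t ht => ?_
    have hexp : ∀ x : ℝ, ‖Complex.exp (t * x * Complex.I)‖ ≤ 1 := fun x => by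
      rw [← Complex.ofReal_mul, Complex.norm_exp_ofReal_mul_I]
    have h3 : inner ℂ η (mulOp (lineChar t) (S ξ)) =
        inner ℂ (ContinuousLinearMap.adjoint S η) (mulOp (lineChar t) ξ) := by
      rw [ContinuousLinearMap.adjoint_inner_left]
      exact congrArg (fun T : L2Line →L[ℂ] L2Line => inner ℂ η (T ξ)) (hS t ht)
    rw [inner_mulOp_lineChar, inner_mulOp_lineChar] at h3
    simp only [mul_sub]
    rw [integral_sub (h1.bdd_mul (c := 1) (by fun_prop) (Filter.Eventually.of_forall hexp))
      (h2.bdd_mul (c := 1) (by fun_prop) (Filter.Eventually.of_forall hexp)), h3, sub_self]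
  filter_upwards [h] with x hx
  exact sub_eq_zero.1 hx

theorem memLp_gaussian :
    MemLp (fun x : ℝ => ((Real.exp (-x ^ 2) : ℝ) : ℂ)) 2 lineMeasure := by
  rw [memLp_two_iff_integrable_sq_norm (by fun_prop)]
  have h : (fun x : ℝ => ‖((Real.exp (-x ^ 2) : ℝ) : ℂ)‖ ^ 2) = fun x => Real.exp (-2 * x ^ 2) := by
    funext x
    rw [Complex.norm_real, Real.norm_of_nonneg (Real.exp_pos _).le, ← Real.exp_nat_mul]
    congr 1
    push_cast; ring
  rw [h, lineMeasure]
  exact (integrable_exp_neg_mul_sq two_pos).smul_measure ENNReal.ofReal_ne_top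

/-- A square-integrable function without zeros. -/
noncomputable def gaussianL2 : L2Line := memLp_gaussian.toLp _

theorem coeFn_gaussianL2 :
    gaussianL2 =ᵐ[lineMeasure] fun x => ((Real.exp (-x ^ 2) : ℝ) : ℂ) :=
  memLp_gaussian.coeFn_toLp

theorem gaussianL2_ne_zero : ∀ᵐ x ∂lineMeasure, gaussianL2 x ≠ 0 := by
  filter_upwards [coeFn_gaussianL2] with x hx
  rw [hx]
  exact_mod_cast (Real.exp_pos _).ne'

instance instSigmaFiniteLineMeasure : SigmaFinite lineMeasure := by
  rw [lineMeasure, ← withDensity_const]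
  infer_instance

/-- Testing S on indicators of sets of finite measure bounds the integral of |f|² over each set by
‖S‖² times its measure. -/
theorem norm_ae_le_of_forall_mul {S : L2Line →L[ℂ] L2Line} {f : ℝ → ℂ} (hf : Measurable f)
    (h : ∀ ξ, S ξ =ᵐ[lineMeasure] fun x => f x * ξ x) : ∀ᵐ x ∂lineMeasure, ‖f x‖ ≤ ‖S‖ := by
  have hpow : ∀ ζ : L2Line, ‖ζ‖ₑ ^ (2 : ℝ) = ∫⁻ x, ‖ζ x‖ₑ ^ (2 : ℝ) ∂lineMeasure := fun ζ => by
    rw [Lp.enorm_def]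
    exact eLpNorm_nnreal_pow_eq_lintegral (p := 2) two_ne_zero
  have hle : (fun x => ‖f x‖ₑ ^ (2 : ℝ)) ≤ᵐ[lineMeasure] fun _ => ‖S‖ₑ ^ (2 : ℝ) := by
    refine ae_le_of_forall_setLIntegral_le_of_sigmaFinite (by fun_prop) fun s hs hμs => ?_
    set χ : L2Line := indicatorConstLp 2 hs hμs.ne (1 : ℂ) with hχ
    have hχs : χ =ᵐ[lineMeasure] s.indicator fun _ => (1 : ℂ) := indicatorConstLp_coeFn
    have h1 : ∫⁻ x in s, ‖f x‖ₑ ^ (2 : ℝ) ∂lineMeasure = ‖S χ‖ₑ ^ (2 : ℝ) := by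
      rw [hpow, ← lintegral_indicator hs]
      refine lintegral_congr_ae ?_
      filter_upwards [h χ, hχs] with x hx1 hx2
      rw [hx1, hx2]
      by_cases hx : x ∈ s <;> simp [hx]
    have h2 : ∫⁻ _ in s, ‖S‖ₑ ^ (2 : ℝ) ∂lineMeasure = ‖S‖ₑ ^ (2 : ℝ) * ‖χ‖ₑ ^ (2 : ℝ) := by
      rw [hpow χ, setLIntegral_const]
      congr 1
      rw [← setLIntegral_one, ← lintegral_indicator hs]
      refine lintegral_congr_ae ?_
      filter_upwards [hχs] with x hx2
      rw [hx2]
      by_cases hx : x ∈ s <;> simp [hx]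
    rw [h1, h2, ← ENNReal.mul_rpow_of_nonneg _ _ zero_le_two]
    exact ENNReal.rpow_le_rpow (S.le_opENorm χ) zero_le_two
  filter_upwards [hle] with x hx
  have h3 : ‖f x‖ₑ ≤ ‖S‖ₑ := (ENNReal.rpow_le_rpow_iff two_pos).1 hx
  simpa [enorm_le_iff_norm_le] using h3

/-- The multiplication operators form a maximal abelian algebra; already multiplication by
`e^{itx}`, for a dense set of `t`, has no other operators in its commutant. -/
theorem exists_eq_mulOp_of_commute {S : L2Line →L[ℂ] L2Line} {D : Set ℝ} (hD : Dense D)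
    (hS : ∀ t ∈ D, mulOp (lineChar t) * S = S * mulOp (lineChar t)) : ∃ f, S = mulOp f := by
  set ψ : L2Line := ContinuousLinearMap.adjoint S gaussianL2 with hψ
  -- Taking η to be the nowhere vanishing Gaussian in `conj_mul_ae_eq_of_commute` permits division,
  -- and the quotient is a multiplier independent of ξ.
  set f : ℝ → ℂ := fun x => (starRingEnd ℂ) (ψ x) / (starRingEnd ℂ) (gaussianL2 x) with hf
  have hfm : Measurable f := by
    have h1 := (Lp.stronglyMeasurable ψ).measurable
    have h2 := (Lp.stronglyMeasurable gaussianL2).measurable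
    exact (Complex.continuous_conj.measurable.comp h1).div
      (Complex.continuous_conj.measurable.comp h2)
  have h : ∀ ξ, S ξ =ᵐ[lineMeasure] fun x => f x * ξ x := fun ξ => by
    filter_upwards [conj_mul_ae_eq_of_commute hD hS ξ gaussianL2, gaussianL2_ne_zero] with x h1 h2
    have h3 : (starRingEnd ℂ) (gaussianL2 x) ≠ 0 := (map_ne_zero _).2 h2
    simp only [hf]
    rw [div_mul_eq_mul_div, eq_div_iff h3, ← h1, mul_comm]
  have hmem : MemLp f ∞ lineMeasure :=
    memLp_top_of_bound hfm.aestronglyMeasurable ‖S‖ (norm_ae_le_of_forall_mul hfm h)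
  refine ⟨hmem.toLp f, mulOp_eq_of_ae fun ξ => ?_⟩
  filter_upwards [h ξ, hmem.coeFn_toLp] with x h1 h2
  rw [h1, h2]

end Operators

/-! ### Cyclicity and the commutant. -/

section CyclicRepresentation

variable {N : ℕ} {m₀ : Circle → ℂ} {K : NNReal}

theorem coeFn_piOne (f : LInftyCircle) (ξ : L2Line) :
    piOne f ξ =ᵐ[lineMeasure] fun x => f (Circle.exp x) * ξ x := by
  filter_upwards [coeFn_mulOp (periodicExtension f) ξ, coeFn_periodicExtension f] with x h1 h2
  rw [piOne, h1, h2]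

theorem piOne_eq_of_ae {f : LInftyCircle} {S : L2Line →L[ℂ] L2Line}
    (h : ∀ ξ, S ξ =ᵐ[lineMeasure] fun x => f (Circle.exp x) * ξ x) : piOne f = S :=
  ContinuousLinearMap.ext fun ξ => Lp.ext ((coeFn_piOne f ξ).trans (h ξ).symm)

theorem quasiMeasurePreserving_div (hN : 2 ≤ N) :
    Measure.QuasiMeasurePreserving (fun x : ℝ => (N : ℝ)⁻¹ * x) lineMeasure lineMeasure := by
  have hN0 : (N : ℝ)⁻¹ ≠ 0 := by positivity
  refine ⟨measurable_const_mul _, ?_⟩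
  rw [lineMeasure, Measure.map_smul, Real.map_volume_mul_left hN0, smul_comm]
  exact Measure.smul_absolutelyContinuous

/-- Up to a nonzero constant, U₁^k ξ is ξ(N^k x), so vanishing near 0 spreads to an interval larger
by N^k. -/
theorem ae_eq_zero_of_uOne_pow (hN : 2 ≤ N) {ε : ℝ} (k : ℕ) (ξ : L2Line)
    (h : ∀ᵐ x ∂lineMeasure, |x| < ε → (uOne hN ^ k) ξ x = 0) :
    ∀ᵐ x ∂lineMeasure, |x| < ε * (N : ℝ) ^ k → ξ x = 0 := by
  have hN0 : (0 : ℝ) < N := by positivity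
  have hs0 : ((√(N : ℝ) : ℝ) : ℂ) ≠ 0 := by
    rw [Complex.ofReal_ne_zero]; positivity
  induction k generalizing ξ with
  | zero => simpa using! h
  | succ k ih =>
    have h1 := ih (uOne hN ξ) (by rw [pow_succ] at h; exact h)
    filter_upwards [(quasiMeasurePreserving_div hN).ae h1,
      (quasiMeasurePreserving_div hN).ae (coeFn_uOne hN ξ)] with x hx1 hx2 hx
    rw [hx2, mul_inv_cancel_left₀ hN0.ne'] at hx1
    refine (mul_eq_zero.1 (hx1 ?_)).resolve_left hs0
    rw [abs_mul, abs_of_pos (inv_pos.2 hN0), inv_mul_lt_iff₀ hN0]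
    calc |x| < ε * (N : ℝ) ^ (k + 1) := hx
      _ = _ := by ring

theorem uOne_mem_generatedAlgebra (hN : 2 ≤ N) : uOne hN ∈ generatedAlgebra (uOne hN) piOne :=
  StarSubalgebra.le_topologicalClosure _ (StarAlgebra.subset_adjoin ℂ _ (by simp))

theorem mulOp_lineChar_one_mem_generatedAlgebra (hN : 2 ≤ N) :
    mulOp (lineChar 1) ∈ generatedAlgebra (uOne hN) piOne := by
  rw [← piOne_coordinate]
  exact StarSubalgebra.le_topologicalClosure _ (StarAlgebra.subset_adjoin ℂ _ (by simp))

theorem dense_setOf_mem_generatedAlgebra (hN : 2 ≤ N) :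
    Dense {t : ℝ | mulOp (lineChar t) ∈ generatedAlgebra (uOne hN) piOne} := by
  have hU' : star (uOne hN) ∈ generatedAlgebra (uOne hN) piOne :=
    star_mem (uOne_mem_generatedAlgebra hN)
  have hneg : mulOp (lineChar (-1)) ∈ generatedAlgebra (uOne hN) piOne := by
    rw [← star_mulOp_lineChar]
    exact star_mem (mulOp_lineChar_one_mem_generatedAlgebra hN)
  exact dense_setOf_mulOp_lineChar_mem hN
    (generatedAlgebra (uOne hN) piOne).toSubalgebra.toSubsemiring.toSubmonoid
    (uOne_mem_generatedAlgebra hN) hU' (mulOp_lineChar_one_mem_generatedAlgebra hN) hneg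

/-- If ξ is orthogonal to the orbit of Φ, then U₁^k ξ is orthogonal to e^{itx}Φ for a dense set of
t, so conj(U₁^k ξ) Φ = 0. Hence U₁^k ξ vanishes where Φ does not, and letting k grow gives ξ = 0. -/
theorem cyclic_of_ae_ne_zero (hN : 2 ≤ N) {Φ : L2Line} {ε : ℝ} (hε : 0 < ε)
    (hΦ : ∀ᵐ x ∂lineMeasure, |x| < ε → Φ x ≠ 0) :
    Dense {ξ : L2Line | ∃ A ∈ generatedAlgebra (uOne hN) piOne, ξ = A Φ} := by
  let ev : (L2Line →L[ℂ] L2Line) →ₗ[ℂ] L2Line :=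
    (ContinuousLinearMap.apply ℂ L2Line Φ).toLinearMap
  let W : Submodule ℂ L2Line :=
    (Subalgebra.toSubmodule (generatedAlgebra (uOne hN) piOne).toSubalgebra).map ev
  have hW : (W : Set L2Line) = {ξ | ∃ A ∈ generatedAlgebra (uOne hN) piOne, ξ = A Φ} := by
    ext ξ
    constructor
    · rintro ⟨A, hA, rfl⟩; exact ⟨A, hA, rfl⟩
    · rintro ⟨A, hA, rfl⟩; exact ⟨A, hA, rfl⟩
  rw [← hW, Submodule.dense_iff_topologicalClosure_eq_top, Submodule.topologicalClosure_eq_top_iff,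
    Submodule.eq_bot_iff]
  intro ξ hξ
  have hzero : ∀ k : ℕ, ∀ᵐ x ∂lineMeasure, |x| < ε → (uOne hN ^ k) ξ x = 0 := by
    intro k
    have h1 := ae_eq_zero_of_integral_exp_mul_eq_zero (integrable_conj_mul ((uOne hN ^ k) ξ) Φ)
      (dense_setOf_mem_generatedAlgebra hN) fun t ht => by
        rw [← inner_mulOp_lineChar, ← ContinuousLinearMap.adjoint_inner_right,
          ← ContinuousLinearMap.star_eq_adjoint]
        have hA : star (uOne hN ^ k) * mulOp (lineChar t) ∈ generatedAlgebra (uOne hN) piOne :=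
          mul_mem (star_mem (pow_mem (uOne_mem_generatedAlgebra hN) k)) ht
        exact (Submodule.mem_orthogonal' W ξ).1 hξ _ ⟨_, hA, rfl⟩
    filter_upwards [h1, hΦ] with x hx1 hx2 hx
    have h2 := (mul_eq_zero.1 hx1).resolve_right (hx2 hx)
    exact (map_eq_zero _).1 h2
  have hall : ∀ᵐ x ∂lineMeasure, ∀ k : ℕ, |x| < ε * (N : ℝ) ^ k → ξ x = 0 :=
    ae_all_iff.2 fun k => ae_eq_zero_of_uOne_pow hN k ξ (hzero k)
  refine Lp.ext ?_
  filter_upwards [hall, Lp.coeFn_zero ℂ 2 lineMeasure] with x hx h0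
  rw [h0]
  have hlim : Filter.Tendsto (fun k : ℕ => ε * (N : ℝ) ^ k) Filter.atTop Filter.atTop :=
    (tendsto_pow_atTop_atTop_of_one_lt (by exact_mod_cast (by omega : 1 < N))).const_mul_atTop hε
  obtain ⟨k, hk⟩ := (hlim.eventually_gt_atTop |x|).exists
  exact hx k hk

theorem isCyclicRepresentation (hN : 2 ≤ N) (hLip : LipschitzWith K m₀)
    (hone : m₀ 1 = ((√(N : ℝ) : ℝ) : ℂ)) (hR : ∀ z, ruelle N m₀ m₀ (fun _ => 1) z = 1) {Φ : L2Line}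
    (hΦ : Φ =ᵐ[lineMeasure] scalingFunction N m₀) :
    IsCyclicRepresentation hN (ofContinuous m₀ hLip.continuous) (hFunction N m₀) (uOne hN) piOne
      Φ where
  unitary := uOne_mem_unitary hN
  map_one := by
    refine piOne_eq_of_ae fun ξ => ?_
    filter_upwards [quasiMeasurePreserving_exp.ae (Lp.coeFn_const ∞ circleHaar (1 : ℂ))] with x hx
    rw [hx, Function.const_apply, one_mul, one_apply_eq_self]
  map_add f g := by
    refine piOne_eq_of_ae fun ξ => ?_
    filter_upwards [quasiMeasurePreserving_exp.ae (Lp.coeFn_add f g), coeFn_piOne f ξ,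
      coeFn_piOne g ξ, Lp.coeFn_add (piOne f ξ) (piOne g ξ)] with x h1 h2 h3 h4
    rw [add_apply, h1, h4, Pi.add_apply, Pi.add_apply, h2, h3, add_mul]
  map_smul c f := by
    refine piOne_eq_of_ae fun ξ => ?_
    filter_upwards [quasiMeasurePreserving_exp.ae (Lp.coeFn_smul c f), coeFn_piOne f ξ,
      Lp.coeFn_smul c (piOne f ξ)] with x h1 h2 h3
    rw [smul_apply, h1, h3, Pi.smul_apply, Pi.smul_apply, h2, smul_mul_assoc]
  map_mul f g := by
    refine piOne_eq_of_ae fun ξ => ?_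
    filter_upwards [quasiMeasurePreserving_exp.ae (Lp.coeFn_lpSMul (r := ∞) f g),
      coeFn_piOne f (piOne g ξ), coeFn_piOne g ξ] with x h1 h2 h3
    change piOne f (piOne g ξ) x = _
    rw [h1, h2, h3, Pi.smul_apply', smul_eq_mul, mul_assoc]
  map_star f := by
    refine (star_mulOp ?_).symm
    filter_upwards [coeFn_periodicExtension (star f), coeFn_periodicExtension f,
      quasiMeasurePreserving_exp.ae (Lp.coeFn_star f)] with x h1 h2 h3
    rw [h1, h2, h3]
    rfl
  covariance f := by
    refine uOne_mul_mulOp hN ?_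
    filter_upwards [coeFn_periodicExtension (powComp hN f),
      quasiMeasurePreserving_exp.ae (coeFn_powComp hN f),
      (quasiMeasurePreserving_mul hN).ae (coeFn_periodicExtension f)] with x h1 h2 h3
    rw [h1, h2, h3, Circle.exp_natCast_mul]
  scaling := by
    have hm : ofContinuous m₀ hLip.continuous =ᵐ[circleHaar] m₀ :=
      ContinuousMap.coeFn_toLp (p := ∞) (𝕜 := ℂ) circleHaar _
    refine Lp.ext ?_
    filter_upwards [coeFn_uOne hN Φ, coeFn_piOne (ofContinuous m₀ hLip.continuous) Φ,
      quasiMeasurePreserving_exp.ae hm, hΦ, (quasiMeasurePreserving_mul hN).ae hΦ]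
      with x h1 h2 h3 h4 h5
    rw [h1, h2, h3, h4, h5, sqrt_mul_scalingFunction_mul hN hLip hone]
  inner_eq f := by
    rw [inner_L2Line,
      ← integral_comp_exp_mul_scalingFunction hN hLip hone hR (Lp.aestronglyMeasurable f)]
    refine integral_congr_ae ?_
    filter_upwards [coeFn_piOne f Φ, hΦ] with x h1 h2
    rw [h1, h2, Complex.ofReal_pow, ← Complex.conj_mul']
    ring
  cyclic := by
    obtain ⟨ε, hε, h⟩ := exists_half_le_norm_scalingFunction_sq hN hLip hone
    refine cyclic_of_ae_ne_zero hN hε ?_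
    filter_upwards [hΦ] with x h1 hx h0
    have h2 := h x hx
    rw [← h1, h0, norm_zero] at h2
    norm_num at h2

theorem mem_dilationInvariantMultipliers_of_commute (hN : 2 ≤ N) {S : L2Line →L[ℂ] L2Line}
    (hU : uOne hN * S = S * uOne hN) (hU' : star (uOne hN) * S = S * star (uOne hN))
    (hpos : mulOp (lineChar 1) * S = S * mulOp (lineChar 1))
    (hneg : mulOp (lineChar (-1)) * S = S * mulOp (lineChar (-1))) :
    S ∈ dilationInvariantMultipliers N := by
  have hmem : ∀ {T : L2Line →L[ℂ] L2Line}, T ∈ Submonoid.centralizer {S} ↔ T * S = S * T := by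
    intro T
    rw [Submonoid.mem_centralizer_iff]
    simp [eq_comm]
  -- The density of available characters is applied to the monoid of operators commuting with S.
  obtain ⟨f, rfl⟩ := exists_eq_mulOp_of_commute (dense_setOf_mulOp_lineChar_mem hN
    (Submonoid.centralizer {S}) (hmem.2 hU) (hmem.2 hU') (hmem.2 hpos) (hmem.2 hneg))
    fun t ht => hmem.1 ht
  refine ⟨f, ae_lineMeasure_iff.1 ?_, rfl⟩
  have hs0 : ((√(N : ℝ) : ℝ) : ℂ) ≠ 0 := by
    rw [Complex.ofReal_ne_zero]; positivity
  -- Commutation with U₁ is evaluated on the Gaussian; since it has no zeros, it cancels and leaves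
  -- f(Nx) = f(x).
  have h := congrArg (fun T : L2Line →L[ℂ] L2Line => T gaussianL2) hU
  change uOne hN (mulOp f gaussianL2) = mulOp f (uOne hN gaussianL2) at h
  filter_upwards [coeFn_uOne hN (mulOp f gaussianL2), coeFn_mulOp f (uOne hN gaussianL2),
    coeFn_uOne hN gaussianL2, (quasiMeasurePreserving_mul hN).ae (coeFn_mulOp f gaussianL2),
    (quasiMeasurePreserving_mul hN).ae gaussianL2_ne_zero] with x h1 h2 h3 h4 h5
  rw [h, h2, h3, h4] at h1
  refine mul_right_cancel₀ (mul_ne_zero hs0 h5) ?_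
  linear_combination -h1

theorem commute_uOne_mulOp (hN : 2 ≤ N) {f : LInftyLine}
    (hf : ∀ᵐ x ∂lineMeasure, f (N * x) = f x) : uOne hN * mulOp f = mulOp f * uOne hN :=
  uOne_mul_mulOp hN (by filter_upwards [hf] with x hx; exact hx.symm)

theorem centralizer_generatedAlgebra (hN : 2 ≤ N) :
    Set.centralizer (generatedAlgebra (uOne hN) piOne : Set (L2Line →L[ℂ] L2Line)) =
      dilationInvariantMultipliers N := by
  ext S
  constructor
  · intro hS
    refine mem_dilationInvariantMultipliers_of_commute hN (hS _ (uOne_mem_generatedAlgebra hN))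
      (hS _ (star_mem (uOne_mem_generatedAlgebra hN)))
      (hS _ (mulOp_lineChar_one_mem_generatedAlgebra hN)) (hS _ ?_)
    rw [← star_mulOp_lineChar]
    exact star_mem (mulOp_lineChar_one_mem_generatedAlgebra hN)
  · rintro ⟨f, hf, rfl⟩
    rw [← ae_lineMeasure_iff] at hf
    have hstar : star (mulOp f) = mulOp (star f) := star_mulOp (Lp.coeFn_star f)
    have hf' : ∀ᵐ x ∂lineMeasure, (star f : LInftyLine) (N * x) = (star f : LInftyLine) x := by
      filter_upwards [hf, Lp.coeFn_star f, (quasiMeasurePreserving_mul hN).ae (Lp.coeFn_star f)]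
        with x h1 h2 h3
      rw [h2, h3, Pi.star_apply, Pi.star_apply, h1]
    -- The star-closed centralizer of M_f is a closed star subalgebra, so only the two generators
    -- need checking. It asks for commutation with the adjoint as well, which is why conj f must be
    -- dilation invariant too.
    have hle : generatedAlgebra (uOne hN) piOne ≤ StarSubalgebra.centralizer ℂ {mulOp f} := by
      refine StarSubalgebra.topologicalClosure_minimal (StarAlgebra.adjoin_le ?_) ?_
      · rintro T (rfl | rfl)
        · rw [SetLike.mem_coe, StarSubalgebra.mem_centralizer_iff]
          rintro _ rfl
          rw [hstar]
          exact ⟨(commute_uOne_mulOp hN hf).symm, (commute_uOne_mulOp hN hf').symm⟩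
        · rw [SetLike.mem_coe, StarSubalgebra.mem_centralizer_iff]
          rintro _ rfl
          rw [hstar]
          exact ⟨commute_mulOp _ _, commute_mulOp _ _⟩
      · rw [StarSubalgebra.coe_centralizer]
        exact Set.isClosed_centralizer _
    intro T hT
    exact (((StarSubalgebra.mem_centralizer_iff ℂ).1 (hle hT)) _ rfl).1.symm

theorem centralizer_insert_uOne_range_piOne (hN : 2 ≤ N) :
    Set.centralizer (insert (uOne hN) (Set.range piOne)) = dilationInvariantMultipliers N := by
  ext S
  constructor
  · intro hS
    have hU : uOne hN * S = S * uOne hN := hS _ (Set.mem_insert _ _)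
    have h1 : mulOp (lineChar 1) * S = S * mulOp (lineChar 1) := by
      rw [← piOne_coordinate]
      exact hS _ (Set.mem_insert_of_mem _ ⟨_, rfl⟩)
    refine mem_dilationInvariantMultipliers_of_commute hN hU ?_ h1 ?_
    -- The given set is not assumed closed under adjoints; U₁ is invertible with inverse its
    -- adjoint, so commutation passes to the adjoint. The same argument serves e^{-ix} below.
    · calc star (uOne hN) * S = star (uOne hN) * S * (uOne hN * star (uOne hN)) := by
            rw [Unitary.mul_star_self_of_mem (uOne_mem_unitary hN), mul_one]
        _ = star (uOne hN) * (S * uOne hN) * star (uOne hN) := by simp only [mul_assoc]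
        _ = star (uOne hN) * uOne hN * S * star (uOne hN) := by rw [← hU]; simp only [mul_assoc]
        _ = S * star (uOne hN) := by
            rw [Unitary.star_mul_self_of_mem (uOne_mem_unitary hN), one_mul]
    · have h2 : mulOp (lineChar (-1)) * mulOp (lineChar 1) = 1 := by
        rw [← mulOp_lineChar_add, neg_add_cancel, mulOp_lineChar_zero]
      have h3 : mulOp (lineChar 1) * mulOp (lineChar (-1)) = 1 := by
        rw [← mulOp_lineChar_add, add_neg_cancel, mulOp_lineChar_zero]
      calc mulOp (lineChar (-1)) * S =
            mulOp (lineChar (-1)) * S * (mulOp (lineChar 1) * mulOp (lineChar (-1))) := by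
            rw [h3, mul_one]
        _ = mulOp (lineChar (-1)) * (S * mulOp (lineChar 1)) * mulOp (lineChar (-1)) := by
            simp only [mul_assoc]
        _ = mulOp (lineChar (-1)) * mulOp (lineChar 1) * S * mulOp (lineChar (-1)) := by
            rw [← h1]; simp only [mul_assoc]
        _ = S * mulOp (lineChar (-1)) := by rw [h2, one_mul]
  · rintro ⟨f, hf, rfl⟩
    rw [← ae_lineMeasure_iff] at hf
    rintro T (rfl | ⟨g, rfl⟩)
    · exact commute_uOne_mulOp hN hf
    · exact commute_mulOp _ _

end CyclicRepresentation

end WaveletGalerkin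

theorem proposition11 (N : ℕ) (hN : 2 ≤ N) (m₀ : Circle → ℂ) (K : NNReal)
    (hLip : LipschitzWith K m₀) (hone : m₀ 1 = ((√(N : ℝ) : ℝ) : ℂ))
    (hR : ∀ z, ruelle N m₀ m₀ (fun _ => 1) z = 1) :
    -- the product converges, is continuous and square integrable
    ((∀ x : ℝ, Multipliable (factor N m₀ x)) ∧
      Continuous (scalingFunction N m₀) ∧
      MemLp (scalingFunction N m₀) 2 volume) ∧
    -- the periodization
    ((∀ x : ℝ, HasSum (fun k : ℤ => ‖scalingFunction N m₀ (x + 2 * k * Real.pi)‖ ^ 2)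
        (hFunction N m₀ (Circle.exp x))) ∧
      (∃ L, LipschitzWith L (hFunction N m₀)) ∧
      (IsTrigPolynomial m₀ → IsTrigPolynomial (fun z => (hFunction N m₀ z : ℂ))) ∧
      IsRuelleFixed N m₀ (hFunction N m₀) ∧
      hFunction N m₀ 1 = 1 ∧
      (∀ C : Set Circle, IsCycle N m₀ C → Disjoint C {1} → ∀ z ∈ C, hFunction N m₀ z = 0)) ∧
    -- the associated cyclic representation
    (∃ Φ : L2Line, Φ =ᵐ[lineMeasure] scalingFunction N m₀ ∧
      IsCyclicRepresentation hN (ofContinuous m₀ hLip.continuous) (hFunction N m₀) (uOne hN) piOne Φ) ∧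
    -- its commutant
    (Set.centralizer (generatedAlgebra (uOne hN) piOne : Set (L2Line →L[ℂ] L2Line)) =
        dilationInvariantMultipliers N ∧
      Set.centralizer (insert (uOne hN) (Set.range piOne)) = dilationInvariantMultipliers N) ∧
    -- minimality
    (∀ (h' : Circle → ℝ) (c : ℝ), Continuous h' → 0 < c →
      (∀ z, 0 ≤ h' z ∧ h' z ≤ c * hFunction N m₀ z) → IsRuelleFixed N m₀ h' →
      ∃ r : ℝ, 0 ≤ r ∧ ∀ z, h' z = r * hFunction N m₀ z) ∧
    -- comparison
    (∀ h : Circle → ℝ, Continuous h → (∀ z, 0 ≤ h z) → IsRuelleFixed N m₀ h → h 1 = 1 →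
      ∀ z, hFunction N m₀ z ≤ h z) := by
  have hc := continuous_scalingFunction hN hLip hone
  have hΦ := (memLp_scalingFunction_lineMeasure hN hLip hone hR).coeFn_toLp
  exact ⟨⟨multipliable_factor hN hLip hone, hc, memLp_scalingFunction hN hLip hone hR⟩,
    ⟨hasSum_hFunction hN hLip hone hR, exists_lipschitzWith_hFunction hN hLip hone hR,
      isTrigPolynomial_hFunction hN hLip hone hR, isRuelleFixed_hFunction hN hLip hone hR,
      hFunction_one hN hLip hone hR,
      fun _ hC hdisj _ hz => hFunction_eq_zero_of_mem_cycle hN hR hC hdisj hz⟩,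
    ⟨_, hΦ, isCyclicRepresentation hN hLip hone hR hΦ⟩,
    ⟨centralizer_generatedAlgebra hN, centralizer_insert_uOne_range_piOne hN⟩,
    -- The factor is forced to be h'(1), since h equals 1 there.
    fun h' _ hh' _ hle hfix => ⟨h' 1, (hle 1).1,
      eq_mul_hFunction_of_le hN hLip hone hR hh' hle hfix⟩,
    fun _ hcont h0 hfix h1 => hFunction_le_of_isRuelleFixed hN hLip hone hR hcont h0 hfix h1⟩
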